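/- Let $\mu_1,\dots,\mu_N$ be absolutely continuous probability measures on $\mathbb{R}$ such that, for every $k$, $\operatorname{supp}\mu_k=[l_k,r_k]$ and $\mu_k$ has a density (possibly unbounded near $l_k$, with the value $+\infty$ allowed at $l_k$) that is nonincreasing on $[l_k,r_k]$. Write $\mathbb{E}(\mu_k)=\int x\,\mu_k(dx)$, and let $\Pi(\mu_1,\dots,\mu_N)$ be the set of transport plans, i.e. probability measures $\gamma$ on $\mathbb{R}^N$ whose $k$-th marginal is $\mu_k$ for every $k$. The tuple $(\mu_1,\dots,\mu_N)$ is called flat if for some $C\in\mathbb{R}$ there is $\gamma\in\Pi(\mu_1,\dots,\mu_N)$ concentrated on the hyperplane $\{x_1+\dots+x_N=C\}$. Then $(\mu_1,\dots,\mu_N)$ is flat if and only if $$r_k-l_k\le \mathbb{E}(\mu_1)+\dots+\mathbb{E}(\mu_N)-(l_1+\dots+l_N)\qquad\text{for all }k=1,\dots,N.$$ Moreover, the cost $c(x_1,\dots,x_N)=-\sum_{i,j=1}^N (x_i-x_j)^2$ is integrable with respect to every $\gamma\in\Pi(\mu_1,\dots,\mu_N)$, and every $\gamma\in\Pi(\mu_1,\dots,\mu_N)$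 that is concentrated on a hyperplane $\{x_1+\dots+x_N=C\}$ minimizes $\int c\,d\gamma'$ over all $\gamma'\in\Pi(\mu_1,\dots,\mu_N)$. -/

import Mathlib

open MeasureTheory
open scoped ENNReal

/-- `μ` has a density with respect to Lebesgue measure which is nonincreasing on `[l, r]`.
The density takes values in `[0, ∞]`, so it may be unbounded near `l`, with value `∞` at `l`. -/
def HasNonincreasingDensityOn (μ : Measure ℝ) (l r : ℝ) : Prop :=
  ∃ ρ : ℝ → ℝ≥0∞, Measurable ρ ∧ μ = volume.withDensity ρ ∧ AntitoneOn ρ (Set.Icc l r)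

/-- `γ` is a transport plan (coupling) with marginals `μ 0, …, μ (N - 1)`. -/
structure IsTransportPlan {N : ℕ} (μ : Fin N → Measure ℝ) (γ : Measure (Fin N → ℝ)) : Prop where
  isProbabilityMeasure : IsProbabilityMeasure γ
  map_eval : ∀ k, γ.map (fun x => x k) = μ k

/-- `γ` is concentrated on the hyperplane `{x | x_1 + ⋯ + x_N = C}`. -/
def ConcentratedOnHyperplane {N : ℕ} (γ : Measure (Fin N → ℝ)) (C : ℝ) : Prop :=
  ∀ᵐ x ∂γ, ∑ i, x i = C

/-- The tuple `μ` is flat: some transport plan is concentrated on a hyperplane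
`{x | x_1 + ⋯ + x_N = C}`. -/
def IsFlatTuple {N : ℕ} (μ : Fin N → Measure ℝ) : Prop :=
  ∃ (C : ℝ) (γ : Measure (Fin N → ℝ)), IsTransportPlan μ γ ∧ ConcentratedOnHyperplane γ C

/-- The repulsive harmonic cost. -/
def repulsiveHarmonicCost {N : ℕ} (x : Fin N → ℝ) : ℝ :=
  -∑ i, ∑ j, (x i - x j) ^ 2

/-! Necessity: a flat plan has `C` equal to the sum of the means, and on the hyperplane `x k` is at
most `C` minus the other left ends. The support is closed, so `r k` obeys the same bound. For the
cost, `repulsiveHarmonicCost` is a separable function plus `2 * (∑ i, x i - C) ^ 2`. All plans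
integrate the separable part alike, and the square vanishes on a flat plan.

Sufficiency: translate so that `l k = 0`, and let `S` be the total mean, so that the supports lie in
`[0, S]`. At scale `S / n` a decreasing density becomes a mixture of uniform distributions on `[0,
j]` with integer labels `j ≤ n`. Uniform distributions on segments have a coupling with constant sum
once no length exceeds half of the total (`exists_coupling_segmentUniform`). The segments `[0, d k]`
may violate this or have the wrong total mean, so only `[d k - l k, d k]` is used, with lengths
tuned to give the target mean exactly. Removing it from `[0, d k]` leaves a multiple of the uniform
distribution on `[0, d k - l k]`, so the remainder is again a label family with the same total mean.

The removable fraction does not depend on the weights (`IsLabelFamily.exists_peel`), so repetition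
makes the uncoupled mass decay geometrically. A small auxiliary coordinate corrects the rounding of
the means, and compactness as `n → ∞` gives an exactly flat plan. -/

/-! ### Uniform distributions on oriented segments -/

/-- The uniform distribution on the segment with end points `c` and `d` (a Dirac mass if `c = d`). -/
noncomputable def segmentUniform (c d : ℝ) : Measure ℝ :=
  (volume.restrict (Set.Icc (0 : ℝ) 1)).map (fun v => c + (d - c) * v)

instance : IsProbabilityMeasure (volume.restrict (Set.Icc (0 : ℝ) 1)) :=
  ⟨by simp⟩

instance segmentUniform_isProbabilityMeasure (c d : ℝ) :
    IsProbabilityMeasure (segmentUniform c d) :=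
  Measure.isProbabilityMeasure_map (by fun_prop)

theorem ofReal_smul_segmentUniform {c d : ℝ} (h : c ≤ d) :
    ENNReal.ofReal (d - c) • segmentUniform c d = volume.restrict (Set.Icc c d) := by
  rcases h.eq_or_lt with rfl | h
  · simp [Measure.restrict_eq_zero.2]
  have hpos : 0 < d - c := sub_pos.2 h
  have hf : Measurable (fun v : ℝ => c + (d - c) * v) := by fun_prop
  have hmap : (volume : Measure ℝ).map (fun v => c + (d - c) * v)
      = ENNReal.ofReal ((d - c)⁻¹) • volume := by
    have : (fun v : ℝ => c + (d - c) * v) = (fun v => c + v) ∘ (fun v => (d - c) * v) := rfl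
    rw [this, ← Measure.map_map (by fun_prop) (by fun_prop), Real.map_volume_mul_left hpos.ne',
      Measure.map_smul, map_add_left_eq_self, abs_of_pos (inv_pos.2 hpos)]
  have hpre : (fun v : ℝ => c + (d - c) * v) ⁻¹' Set.Icc c d = Set.Icc 0 1 := by
    ext v
    simp only [Set.mem_preimage, Set.mem_Icc]
    constructor
    · rintro ⟨h1, h2⟩
      constructor <;> nlinarith
    · rintro ⟨h1, h2⟩
      constructor <;> nlinarith
  have := Measure.restrict_map (μ := (volume : Measure ℝ)) hf (measurableSet_Icc (a := c) (b := d))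
  rw [hpre, hmap] at this
  rw [segmentUniform, ← this, Measure.restrict_smul, smul_smul, ← ENNReal.ofReal_mul hpos.le,
    mul_inv_cancel₀ hpos.ne']
  simp

theorem ofReal_smul_segmentUniform_split {a b c : ℝ} (hab : a ≤ b) (hbc : b ≤ c) :
    ENNReal.ofReal (c - a) • segmentUniform a c
      = ENNReal.ofReal (b - a) • segmentUniform a b
        + ENNReal.ofReal (c - b) • segmentUniform b c := by
  rw [ofReal_smul_segmentUniform hab, ofReal_smul_segmentUniform hbc,
    ofReal_smul_segmentUniform (hab.trans hbc),
    ← Measure.restrict_congr_set (Ioc_ae_eq_Icc (a := a) (b := c)),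
    ← Measure.restrict_congr_set (Ioc_ae_eq_Icc (a := a) (b := b)),
    ← Measure.restrict_congr_set (Ioc_ae_eq_Icc (a := b) (b := c)),
    ← Set.Ioc_union_Ioc_eq_Ioc hab hbc,
    Measure.restrict_union (Set.Ioc_disjoint_Ioc_of_le le_rfl) measurableSet_Ioc]

theorem segmentUniform_zero_one : segmentUniform 0 1 = volume.restrict (Set.Icc (0 : ℝ) 1) := by
  simp [segmentUniform]

/-- Orientation does not change the law; it matters only for couplings, where some coordinates run
downwards. -/
theorem segmentUniform_one_zero : segmentUniform 1 0 = segmentUniform 0 1 := by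
  have h := (Measure.measurePreserving_sub_left (volume : Measure ℝ) 1).restrict_preimage
    (measurableSet_Icc (a := (0 : ℝ)) (b := 1))
  have hpre : (fun x : ℝ => 1 - x) ⁻¹' Set.Icc 0 1 = Set.Icc 0 1 := by
    ext v; simp only [Set.mem_preimage, Set.mem_Icc]
    constructor <;> rintro ⟨h1, h2⟩ <;> constructor <;> linarith
  rw [hpre] at h
  rw [segmentUniform_zero_one, segmentUniform]
  have hfun : (fun v : ℝ => 1 + (0 - 1) * v) = fun v => 1 - v := by funext v; ring
  rw [hfun]
  exact h.map_eq

theorem map_affine_segmentUniform (c l p q : ℝ) :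
    (segmentUniform p q).map (fun v => c + l * v) = segmentUniform (c + l * p) (c + l * q) := by
  rw [segmentUniform, Measure.map_map (by fun_prop) (by fun_prop), segmentUniform]
  congr 1; ext v; simp; ring

/-! ### Coupling three uniform variables along a triangle -/

/-- Mixture over a cycle of three edges; the first covers `[0, 1]`, the others tile it. -/
theorem smul_segmentUniform_three {u v w p : ℝ} (hu : 0 ≤ u) (hv : 0 ≤ v) (hw : 0 ≤ w)
    (hsum : u + v + w = 1) (hp0 : 0 ≤ p) (hp1 : p ≤ 1) (hp : v = (v + w) * p) :
    ENNReal.ofReal u • segmentUniform 1 0 + ENNReal.ofReal v • segmentUniform 0 p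
      + ENNReal.ofReal w • segmentUniform p 1 = segmentUniform 0 1 := by
  have hw' : w = (v + w) * (1 - p) := by linear_combination -hp
  have hsplit := ofReal_smul_segmentUniform_split hp0 hp1
  simp only [sub_zero, ENNReal.ofReal_one, one_smul] at hsplit
  have h2 : ENNReal.ofReal v • segmentUniform 0 p + ENNReal.ofReal w • segmentUniform p 1
      = ENNReal.ofReal (v + w) • segmentUniform 0 1 := by
    conv_rhs => rw [hsplit]
    rw [smul_add, smul_smul, smul_smul, ← ENNReal.ofReal_mul (by positivity),
      ← ENNReal.ofReal_mul (by positivity), ← hp, ← hw']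
  rw [add_assoc, h2, segmentUniform_one_zero, ← add_smul, ← ENNReal.ofReal_add hu (by positivity)]
  rw [← add_assoc, hsum]; simp

/-- A measure carried by three parametrized segments. -/
noncomputable def threeSegments (w : Fin 3 → ℝ) (s t : Fin 3 → Fin 3 → ℝ) :
    Measure (Fin 3 → ℝ) :=
  ∑ e, ENNReal.ofReal (w e) •
    (volume.restrict (Set.Icc (0 : ℝ) 1)).map (fun v i => s e i + (t e i - s e i) * v)

theorem threeSegments_map_eval (w : Fin 3 → ℝ) (s t : Fin 3 → Fin 3 → ℝ) (i : Fin 3) :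
    (threeSegments w s t).map (fun x => x i)
      = ∑ e, ENNReal.ofReal (w e) • segmentUniform (s e i) (t e i) := by
  have hm : Measurable (fun x : Fin 3 → ℝ => x i) := measurable_pi_apply i
  simp only [threeSegments, Fin.sum_univ_three]
  rw [Measure.map_add _ _ hm, Measure.map_add _ _ hm]
  simp only [Measure.map_smul]
  have hseg : ∀ e, Measurable (fun (v : ℝ) (i : Fin 3) => s e i + (t e i - s e i) * v) :=
    fun e => measurable_pi_lambda _ fun i => by fun_prop
  simp only [Measure.map_map hm (hseg _)]
  rfl

/-- An affine constraint holds along a segment once it holds at both ends. Segments of weight zero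
are exempt, which lets the degenerate triangles use dummy edges. -/
theorem threeSegments_ae (w : Fin 3 → ℝ) (s t : Fin 3 → Fin 3 → ℝ) (a : Fin 3 → ℝ) (C : ℝ)
    (hs : ∀ e, 0 < w e → ∑ i, a i * s e i = C) (ht : ∀ e, 0 < w e → ∑ i, a i * t e i = C) :
    ∀ᵐ x ∂threeSegments w s t, ∑ i, a i * x i = C := by
  have hmeas : MeasurableSet {x : Fin 3 → ℝ | ∑ i, a i * x i = C} :=
    measurableSet_eq_fun (by fun_prop) (by fun_prop)
  have hseg : ∀ e, Measurable (fun (v : ℝ) (i : Fin 3) => s e i + (t e i - s e i) * v) :=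
    fun e => measurable_pi_lambda _ fun i => by fun_prop
  have key : ∀ e, ∀ᵐ x ∂(ENNReal.ofReal (w e) •
      (volume.restrict (Set.Icc (0 : ℝ) 1)).map (fun v i => s e i + (t e i - s e i) * v)),
      ∑ i, a i * x i = C := by
    intro e
    rcases le_or_gt (w e) 0 with h | h
    · rw [ENNReal.ofReal_of_nonpos h]; simp
    · apply Measure.ae_smul_measure
      rw [ae_map_iff (hseg e).aemeasurable hmeas]
      refine Filter.Eventually.of_forall fun v => ?_
      have h1 := hs e h
      have h2 := ht e h
      simp only [Fin.sum_univ_three] at h1 h2 ⊢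
      linear_combination (1 - v) * h1 + v * h2
  rw [threeSegments, Fin.sum_univ_three, ae_add_measure_iff, ae_add_measure_iff]
  exact ⟨⟨key 0, key 1⟩, key 2⟩

/-- Three variables, uniform on `[0, 1]`, can be coupled so that a linear combination whose
coefficients satisfy the triangle inequalities is constant. -/
theorem exists_coupling_three_uniform (a : Fin 3 → ℝ)
    (h0 : a 0 ≤ a 1 + a 2) (h1 : a 1 ≤ a 0 + a 2) (h2 : a 2 ≤ a 0 + a 1) :
    ∃ τ : Measure (Fin 3 → ℝ), (∀ i, τ.map (fun x => x i) = segmentUniform 0 1) ∧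
      ∀ᵐ x ∂τ, ∑ i, a i * x i = (a 0 + a 1 + a 2) / 2 := by
  -- Half the slacks in the triangle inequalities; each coefficient is the sum of two of them.
  obtain ⟨P, hP⟩ : ∃ P, P = (a 1 + a 2 - a 0) / 2 := ⟨_, rfl⟩
  obtain ⟨Q, hQ⟩ : ∃ Q, Q = (a 0 + a 2 - a 1) / 2 := ⟨_, rfl⟩
  obtain ⟨R, hR⟩ : ∃ R, R = (a 0 + a 1 - a 2) / 2 := ⟨_, rfl⟩
  have hP0 : 0 ≤ P := by rw [hP]; linarith
  have hQ0 : 0 ≤ Q := by rw [hQ]; linarith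
  have hR0 : 0 ≤ R := by rw [hR]; linarith
  have ha0 : a 0 = Q + R := by rw [hQ, hR]; ring
  have ha1 : a 1 = P + R := by rw [hP, hR]; ring
  have ha2 : a 2 = P + Q := by rw [hP, hQ]; ring
  have hQR := mul_nonneg hQ0 hR0
  have hPR := mul_nonneg hP0 hR0
  have hPQ := mul_nonneg hP0 hQ0
  rcases (by positivity : 0 ≤ Q * R + P * R + P * Q).eq_or_lt with hD | hD
  · -- degenerate triangle: a single segment suffices
    have e1 : Q * R = 0 := by linarith
    have e2 : P * R = 0 := by linarith
    have e3 : P * Q = 0 := by linarith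
    -- If `R = 0` then `a 2 = a 0 + a 1`, and the third variable runs against the other two.
    -- Otherwise `a 0 = a 1` and `a 2 = 0`, so the first two run against each other.
    by_cases hR' : R = 0
    · refine ⟨threeSegments ![1, 0, 0] ![![0, 0, 1], 0, 0] ![![1, 1, 0], 0, 0], ?_, ?_⟩
      · intro i
        rw [threeSegments_map_eval]
        fin_cases i <;> simp [Fin.sum_univ_three, segmentUniform_one_zero]
      · apply threeSegments_ae
        all_goals
          intro e he
          fin_cases e <;> simp [Fin.sum_univ_three] at he ⊢
          linarith
    · have hQ' : Q = 0 := by simpa [hR'] using e1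
      have hP' : P = 0 := by simpa [hR'] using e2
      refine ⟨threeSegments ![1, 0, 0] ![![0, 1, 0], 0, 0] ![![1, 0, 1], 0, 0], ?_, ?_⟩
      · intro i
        rw [threeSegments_map_eval]
        fin_cases i <;> simp [Fin.sum_univ_three, segmentUniform_one_zero]
      · apply threeSegments_ae
        all_goals
          intro e he
          fin_cases e <;> simp [Fin.sum_univ_three] at he ⊢
          linarith
  · obtain ⟨D, hDdef⟩ : ∃ D, D = Q * R + P * R + P * Q := ⟨_, rfl⟩
    rw [← hDdef] at hD
    have frac : ∀ {x y : ℝ}, 0 ≤ x → 0 ≤ y → 0 ≤ x / (x + y) ∧ x / (x + y) ≤ 1 := by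
      intro x y hx hy
      exact ⟨by positivity, div_le_one_of_le₀ (by linarith) (by positivity)⟩
    have tile : ∀ {x y z : ℝ}, 0 ≤ x → 0 ≤ y → z * x / D = (z * x / D + z * y / D) * (x / (x + y)) := by
      intro x y z hx hy
      rcases (add_nonneg hx hy).eq_or_lt with h | h
      · have : x = 0 := by linarith
        simp [this]
      · field_simp
    -- The edges form a closed triangle in the slice of the cube by the hyperplane. For each
    -- coordinate one edge sweeps `[0, 1]`, and the other two tile it with weights proportional to
    -- their lengths.
    refine ⟨threeSegments ![Q * R / D, P * R / D, P * Q / D]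
      ![![1, P / (P + R), 0], ![0, 1, Q / (Q + P)], ![R / (R + Q), 0, 1]]
      ![![0, 1, Q / (Q + P)], ![R / (R + Q), 0, 1], ![1, P / (P + R), 0]], ?_, ?_⟩
    · intro i
      rw [threeSegments_map_eval]
      fin_cases i
      · have := smul_segmentUniform_three (u := Q * R / D) (v := P * R / D) (w := P * Q / D)
          (by positivity) (by positivity) (by positivity) (by field_simp; linarith)
          (frac hR0 hQ0).1 (frac hR0 hQ0).2 (tile hR0 hQ0)
        simpa [Fin.sum_univ_three] using this
      · have := smul_segmentUniform_three (u := P * R / D) (v := P * Q / D) (w := Q * R / D)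
          (by positivity) (by positivity) (by positivity) (by field_simp; linarith)
          (frac hP0 hR0).1 (frac hP0 hR0).2
          (by have := tile (z := Q) hP0 hR0; rwa [mul_comm Q P] at this)
        rw [← this]
        simp [Fin.sum_univ_three]
        abel
      · have := smul_segmentUniform_three (u := P * Q / D) (v := Q * R / D) (w := P * R / D)
          (by positivity) (by positivity) (by positivity) (by field_simp; linarith)
          (frac hQ0 hP0).1 (frac hQ0 hP0).2
          (by have := tile (z := R) hQ0 hP0; rwa [mul_comm R Q, mul_comm R P] at this)
        rw [← this]
        simp [Fin.sum_univ_three]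
        abel
    · have corner : ∀ {x y : ℝ}, 0 ≤ x → 0 ≤ y → (y + x) * (x / (x + y)) = x := by
        intro x y hx hy
        rcases (add_nonneg hx hy).eq_or_lt with h | h
        · have : x = 0 := by linarith
          simp [this]
        · field_simp; ring
      have c1 : (P + R) * (P / (P + R)) = P := by
        have := corner hP0 hR0; rwa [add_comm R P] at this
      have c2 : (P + Q) * (Q / (Q + P)) = Q := corner hQ0 hP0
      have c3 : (Q + R) * (R / (R + Q)) = R := corner hR0 hQ0
      apply threeSegments_ae
      all_goals
        intro e _
        fin_cases e <;> simp [Fin.sum_univ_three, ha0, ha1, ha2] <;> linarith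

/-! ### From three segments to finitely many -/

/-- Nonnegative lengths, each at most half of the total, can be distributed into three groups
whose totals are each at most half of the total. -/
theorem exists_three_groups {N : ℕ} (b : Fin N → ℝ) (h0 : ∀ k, 0 ≤ b k)
    (hb : ∀ k, 2 * b k ≤ ∑ i, b i) :
    ∃ g : Fin N → Fin 3, ∀ e, 2 * ∑ i with g i = e, b i ≤ ∑ i, b i := by
  classical
  have hT : 0 ≤ ∑ i, b i := Finset.sum_nonneg fun i _ => h0 i
  -- Adding any further `k` to a maximal `A` exceeds half of the total, so the complement of `insert
  -- k A` is below half. The groups are `A`, `{k}` and this complement.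
  obtain ⟨A, hA⟩ := Set.Finite.exists_maximal
    (s := {A : Finset (Fin N) | 2 * ∑ i ∈ A, b i ≤ ∑ i, b i}) (Set.toFinite _)
    ⟨∅, by simpa using hT⟩
  have hA1 : 2 * ∑ i ∈ A, b i ≤ ∑ i, b i := hA.prop
  by_cases hAu : ∀ k, k ∈ A
  · have hAu' : A = Finset.univ := by ext k; simp [hAu k]
    rw [hAu'] at hA1
    have hz : ∑ i, b i = 0 := by linarith
    refine ⟨fun _ => 0, fun e => ?_⟩
    have : ∑ i with (0 : Fin 3) = e, b i ≤ ∑ i, b i :=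
      Finset.sum_le_sum_of_subset_of_nonneg (Finset.filter_subset _ _) fun i _ _ => h0 i
    linarith
  · push Not at hAu
    obtain ⟨k, hk⟩ := hAu
    have hk2 : ∑ i, b i < 2 * ∑ i ∈ insert k A, b i := by
      by_contra hcon
      push Not at hcon
      exact hk (hA.le_of_ge hcon (Finset.subset_insert k A) (Finset.mem_insert_self k A))
    rw [Finset.sum_insert hk] at hk2
    refine ⟨fun i => if i ∈ A then 0 else if i = k then 1 else 2, fun e => ?_⟩
    have hsplit : ∑ i, b i = ∑ i ∈ A, b i + b k + ∑ i with i ∉ A ∧ i ≠ k, b i := by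
      rw [add_comm (∑ i ∈ A, b i), ← Finset.sum_insert hk,
        ← Finset.sum_add_sum_compl (insert k A)]
      congr 2
      ext i
      simp [and_comm]
    have e0 : (Finset.univ.filter fun i => (if i ∈ A then (0 : Fin 3) else if i = k then 1 else 2) = 0)
        = A := by
      ext i; by_cases h : i ∈ A <;> by_cases h' : i = k <;> simp [h, h']
    have e1 : (Finset.univ.filter fun i => (if i ∈ A then (0 : Fin 3) else if i = k then 1 else 2) = 1)
        = {k} := by
      ext i
      by_cases h : i ∈ A
      · have : i ≠ k := fun h' => hk (h' ▸ h)
        simp [h, this]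
      · by_cases h' : i = k <;> simp [h, h', hk]
    have e2 : (Finset.univ.filter fun i => (if i ∈ A then (0 : Fin 3) else if i = k then 1 else 2) = 2)
        = Finset.univ.filter fun i => i ∉ A ∧ i ≠ k := by
      ext i
      by_cases h : i ∈ A
      · simp [h]
      · by_cases h' : i = k <;> simp [h, h', hk]
    have he : e = 0 ∨ e = 1 ∨ e = 2 := by fin_cases e <;> simp
    rcases he with rfl | rfl | rfl
    · beta_reduce
      rwa [e0]
    · beta_reduce
      rw [e1, Finset.sum_singleton]
      exact hb k
    · beta_reduce
      rw [e2]
      linarith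

/-- Uniform distributions on segments whose lengths satisfy the polygon inequality admit a coupling
with constant sum. -/
theorem exists_coupling_segmentUniform {N : ℕ} (c b : Fin N → ℝ) (h0 : ∀ k, 0 ≤ b k)
    (hb : ∀ k, 2 * b k ≤ ∑ i, b i) :
    ∃ γ : Measure (Fin N → ℝ), IsTransportPlan (fun k => segmentUniform (c k) (c k + b k)) γ ∧
      ConcentratedOnHyperplane γ (∑ i, c i + (∑ i, b i) / 2) := by
  obtain ⟨g, hg⟩ := exists_three_groups b h0 hb
  obtain ⟨a, ha⟩ : ∃ a : Fin 3 → ℝ, a = fun e => ∑ i with g i = e, b i := ⟨_, rfl⟩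
  have hsum : a 0 + a 1 + a 2 = ∑ i, b i := by
    rw [← Fin.sum_univ_three, ha, Finset.sum_fiberwise]
  have hg' : ∀ e, 2 * a e ≤ ∑ i, b i := by rw [ha]; exact hg
  obtain ⟨τ, hτ, hτC⟩ := exists_coupling_three_uniform a
    (by linarith [hg' 0]) (by linarith [hg' 1]) (by linarith [hg' 2])
  have hτp : IsProbabilityMeasure τ := by
    constructor
    have := congrArg (fun ν : Measure ℝ => ν Set.univ) (hτ 0)
    simpa [Measure.map_apply (measurable_pi_apply (0 : Fin 3)) MeasurableSet.univ] using this
  -- All coordinates of a group are driven by one variable, so the group acts as a single segment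
  -- whose length is the sum.
  have hm : Measurable (fun (x : Fin 3 → ℝ) (k : Fin N) => c k + b k * x (g k)) :=
    measurable_pi_lambda _ fun k => by fun_prop
  refine ⟨τ.map fun x k => c k + b k * x (g k),
    ⟨Measure.isProbabilityMeasure_map hm.aemeasurable, fun k => ?_⟩, ?_⟩
  · rw [Measure.map_map (measurable_pi_apply k) hm]
    have : ((fun x : Fin N → ℝ => x k) ∘ fun (x : Fin 3 → ℝ) (k : Fin N) => c k + b k * x (g k))
        = (fun v => c k + b k * v) ∘ fun x => x (g k) := rfl
    rw [this, ← Measure.map_map (g := fun v : ℝ => c k + b k * v)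
      (f := fun x : Fin 3 → ℝ => x (g k)) (by fun_prop) (by fun_prop), hτ,
      map_affine_segmentUniform]
    simp
  · unfold ConcentratedOnHyperplane
    rw [ae_map_iff hm.aemeasurable (measurableSet_eq_fun (by fun_prop) (by fun_prop))]
    filter_upwards [hτC] with x hx
    rw [hsum] at hx
    rw [Finset.sum_add_distrib, ← hx, ha]
    congr 1
    rw [← Finset.sum_fiberwise Finset.univ g]
    refine Finset.sum_congr rfl fun e _ => ?_
    rw [Finset.sum_mul]
    refine Finset.sum_congr rfl fun i hi => ?_
    rw [(Finset.mem_filter.1 hi).2]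

/-! ### Integer selection lemmas -/

/-- An integer vector with prescribed sum between two bounds. -/
theorem exists_nat_vector_between {ι : Type*} (s : Finset ι) (lo hi : ι → ℕ)
    (h : ∀ i ∈ s, lo i ≤ hi i) (T : ℕ) (h1 : ∑ i ∈ s, lo i ≤ T) (h2 : T ≤ ∑ i ∈ s, hi i) :
    ∃ b : ι → ℕ, (∀ i ∈ s, lo i ≤ b i ∧ b i ≤ hi i) ∧ ∑ i ∈ s, b i = T := by
  classical
  induction s using Finset.induction_on generalizing T with
  | empty => exact ⟨lo, by simp, by simp at h1 h2 ⊢; omega⟩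
  | insert a s ha ih =>
    rw [Finset.sum_insert ha] at h1 h2
    have hs : ∑ i ∈ s, lo i ≤ ∑ i ∈ s, hi i :=
      Finset.sum_le_sum fun i hi => h i (Finset.mem_insert_of_mem hi)
    have haa := h a (Finset.mem_insert_self a s)
    obtain ⟨b, hb, hbs⟩ := ih (fun i hi => h i (Finset.mem_insert_of_mem hi))
      -- The smallest admissible target for `s` that leaves at most `hi a` for `a`; the subtraction
      -- is truncated.
      (max (∑ i ∈ s, lo i) (T - hi a)) (by omega) (by omega)
    refine ⟨Function.update b a (T - ∑ i ∈ s, b i), ?_, ?_⟩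
    · intro i hi
      rcases Finset.mem_insert.1 hi with rfl | hi'
      · simp only [Function.update_self]
        omega
      · rw [Function.update_of_ne (ne_of_mem_of_not_mem hi' ha)]
        exact hb i hi'
    · rw [Finset.sum_insert ha, Function.update_self, Finset.sum_congr rfl fun i hi =>
        Function.update_of_ne (ne_of_mem_of_not_mem hi ha) _ _]
      omega

/-- Moving from a vector of sum at most `T` to one of sum at least `T`, one coordinate at a time. -/
theorem exists_mixed_selection {N : ℕ} (a b : Fin N → ℕ) (n T : ℕ) (hb : ∀ k, b k ≤ n)
    (ha : ∑ k, a k ≤ T) (hbT : T ≤ ∑ k, b k) :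
    ∃ d : Fin N → ℕ, (∀ k, d k = a k ∨ d k = b k) ∧ ∑ k, d k ≤ T ∧ T ≤ ∑ k, d k + n := by
  classical
  -- Switching one more coordinate to `b` overshoots `T`, and a single switch raises the sum by at
  -- most `n`.
  obtain ⟨A, hA⟩ := Set.Finite.exists_maximal
    (s := {A : Finset (Fin N) | ∑ k, (if k ∈ A then b k else a k) ≤ T}) (Set.toFinite _)
    ⟨∅, by simpa using ha⟩
  have hA1 : ∑ k, (if k ∈ A then b k else a k) ≤ T := hA.prop
  refine ⟨fun k => if k ∈ A then b k else a k, fun k => by by_cases h : k ∈ A <;> simp [h], hA1, ?_⟩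
  beta_reduce
  by_cases hAu : ∀ k, k ∈ A
  · simp only [hAu, if_true]; omega
  · push Not at hAu
    obtain ⟨k, hk⟩ := hAu
    have hk2 : T < ∑ i, (if i ∈ insert k A then b i else a i) := by
      by_contra hcon
      push Not at hcon
      exact hk (hA.le_of_ge hcon (Finset.subset_insert k A) (Finset.mem_insert_self k A))
    have : ∑ i, (if i ∈ insert k A then b i else a i)
        ≤ ∑ i, ((if i ∈ A then b i else a i) + if i = k then n else 0) := by
      refine Finset.sum_le_sum fun i _ => ?_
      by_cases hi : i = k
      · subst hi; simp [hk]; have := hb i; omega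
      · simp [hi]
    rw [Finset.sum_add_distrib, Finset.sum_ite_eq' Finset.univ k, if_pos (Finset.mem_univ k)] at this
    omega

/-- If `d` has entries at most `S` and sum `S + Q` with `Q ≤ S`, truncation at `Q` leaves a sum of
at least `2 * Q`. -/
theorem two_mul_le_sum_min {N : ℕ} (d : Fin N → ℕ) (S Q : ℕ) (hd : ∀ k, d k ≤ S)
    (hsum : ∑ k, d k = S + Q) (hQ : Q ≤ S) : 2 * Q ≤ ∑ k, min (d k) Q := by
  classical
  -- Two entries of size at least `Q` suffice. With only one, the others are untruncated and sum to
  -- at least `Q` because `d p ≤ S`; with none, nothing is truncated.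
  by_cases h : ∃ p, Q ≤ d p
  · obtain ⟨p, hp⟩ := h
    rw [← Finset.add_sum_erase _ _ (Finset.mem_univ p)] at hsum ⊢
    have hp' := hd p
    by_cases h' : ∃ q ∈ Finset.univ.erase p, Q ≤ d q
    · obtain ⟨q, hq, hq'⟩ := h'
      have := Finset.single_le_sum (f := fun k => min (d k) Q) (fun i _ => Nat.zero_le _) hq
      beta_reduce at this
      omega
    · push Not at h'
      have : ∑ k ∈ Finset.univ.erase p, min (d k) Q = ∑ k ∈ Finset.univ.erase p, d k :=
        Finset.sum_congr rfl fun k hk => min_eq_left (h' k hk).le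
      omega
  · push Not at h
    have : ∑ k, min (d k) Q = ∑ k, d k := Finset.sum_congr rfl fun k _ => min_eq_left (h k).le
    omega

/-! ### Peeling flat pieces off label families -/

/-- Mixture of the uniform distributions on `[0, j]`, `j ≤ n`, with weights `w j`. -/
noncomputable def labelMixture (n : ℕ) (w : ℕ → ℝ) : Measure ℝ :=
  ∑ j ∈ Finset.range (n + 1), ENNReal.ofReal (w j) • segmentUniform 0 j

theorem labelMixture_isProbabilityMeasure {n : ℕ} {w : ℕ → ℝ} (h0 : ∀ j, 0 ≤ w j)
    (h1 : ∑ j ∈ Finset.range (n + 1), w j = 1) : IsProbabilityMeasure (labelMixture n w) := by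
  constructor
  simp only [labelMixture, Measure.coe_finsetSum, Finset.sum_apply, Measure.smul_apply,
    measure_univ, smul_eq_mul, mul_one]
  rw [← ENNReal.ofReal_sum_of_nonneg fun j _ => h0 j, h1, ENNReal.ofReal_one]

theorem labelMixture_add_single {n : ℕ} {u : ℕ → ℝ} (hu : ∀ j, 0 ≤ u j) {t : ℝ} (ht : 0 ≤ t)
    {i : ℕ} (hi : i ≤ n) :
    labelMixture n (fun j => u j + if j = i then t else 0)
      = labelMixture n u + ENNReal.ofReal t • segmentUniform 0 i := by
  have : ∀ j, ENNReal.ofReal (u j + if j = i then t else 0)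
      = ENNReal.ofReal (u j) + if j = i then ENNReal.ofReal t else 0 := by
    intro j
    split_ifs
    · exact ENNReal.ofReal_add (hu j) ht
    · simp
  simp only [labelMixture, this, add_smul, Finset.sum_add_distrib, ite_smul, zero_smul]
  rw [Finset.sum_ite_eq' (Finset.range (n + 1)) i, if_pos (Finset.mem_range.2 (by omega))]

theorem ofReal_smul_labelMixture {n : ℕ} {a : ℝ} (ha : 0 ≤ a) (w : ℕ → ℝ) :
    ENNReal.ofReal a • labelMixture n w = labelMixture n fun j => a * w j := by
  simp only [labelMixture, Finset.smul_sum, smul_smul, ENNReal.ofReal_mul ha]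

/-- A small multiple of the uniform distribution on a segment ending at a charged label can be
removed from a mixture of the uniform distributions on `[0, j]`. -/
theorem labelMixture_peel {n : ℕ} {w : ℕ → ℝ} (h0 : ∀ j, 0 ≤ w j)
    (h1 : ∑ j ∈ Finset.range (n + 1), w j = 1) {c b d : ℕ} (hd : d ≤ n) (hcb : c + b = d)
    (hb : 0 < d → 0 < b) {θ : ℝ} (hθ0 : 0 ≤ θ) (hθ1 : θ < 1) (hθ : θ * (n + 1) ≤ w d) :
    ∃ w' : ℕ → ℝ, (∀ j, 0 ≤ w' j) ∧ ∑ j ∈ Finset.range (n + 1), w' j = 1 ∧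
      (1 - θ) * ∑ j ∈ Finset.range (n + 1), w' j * j
        = ∑ j ∈ Finset.range (n + 1), w j * j - θ * (2 * c + b) ∧
      labelMixture n w = ENNReal.ofReal θ • segmentUniform c (c + b)
        + ENNReal.ofReal (1 - θ) • labelMixture n w' := by
  have hθ1' : 0 < 1 - θ := by linarith
  -- For `d > 0`, `m = d / b` copies of the uniform law on `[0, d]` split into one copy on `[c, d]`
  -- and `m - 1` copies on `[0, c]`. For `d = 0` all three are the point mass at zero.
  obtain ⟨m, hm1, hmn, hmean, hsplit⟩ : ∃ m : ℝ, 1 ≤ m ∧ m ≤ n + 1 ∧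
      m * d - (m - 1) * c = 2 * c + b ∧
      ENNReal.ofReal m • segmentUniform 0 d
        = segmentUniform c (c + b) + ENNReal.ofReal (m - 1) • segmentUniform 0 c := by
    rcases Nat.eq_zero_or_pos d with rfl | hdp
    · obtain ⟨rfl, rfl⟩ : c = 0 ∧ b = 0 := by omega
      exact ⟨1, le_rfl, by simp, by simp, by simp⟩
    · have hbp : (0 : ℝ) < b := by exact_mod_cast hb hdp
      have hb1 : (1 : ℝ) ≤ b := by exact_mod_cast hb hdp
      have hdc : (d : ℝ) = c + b := by exact_mod_cast hcb.symm
      have hdn : (d : ℝ) ≤ n := by exact_mod_cast hd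
      have hc0 : (0 : ℝ) ≤ c := by positivity
      refine ⟨d / b, ?_, ?_, ?_, ?_⟩
      · rw [le_div_iff₀ hbp]; linarith
      · rw [div_le_iff₀ hbp]; nlinarith
      · rw [hdc]; field_simp; ring
      · have h := ofReal_smul_segmentUniform_split hc0 (by linarith : (c : ℝ) ≤ c + b)
        rw [← hdc] at h ⊢
        have h' := congrArg (fun ν => ENNReal.ofReal (1 / b) • ν) h
        simp only [smul_add, smul_smul, ← ENNReal.ofReal_mul (by positivity : (0 : ℝ) ≤ 1 / b)] at h'
        rw [show (1 / b * (d - 0) : ℝ) = d / b by ring,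
          show (1 / b * (c - 0) : ℝ) = d / b - 1 by rw [hdc]; field_simp; ring,
          show (1 / b * (d - c) : ℝ) = 1 by rw [hdc]; field_simp; ring,
          ENNReal.ofReal_one, one_smul, add_comm] at h'
        exact h'
  have hcn : c ≤ n := by omega
  have hu : ∀ j, 0 ≤ w j - if j = d then θ * m else 0 := by
    intro j
    split_ifs with h
    · subst h
      have := mul_le_mul_of_nonneg_left hmn hθ0
      linarith
    · simpa using h0 j
  have ht : 0 ≤ θ * (m - 1) := mul_nonneg hθ0 (by linarith)
  have hsum1 : ∀ (t : ℝ) (i : ℕ), i ≤ n →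
      ∑ j ∈ Finset.range (n + 1), (if j = i then t else 0) = t := by
    intro t i hi
    rw [Finset.sum_ite_eq' (Finset.range (n + 1)) i, if_pos (Finset.mem_range.2 (by omega))]
  have hsum2 : ∀ (t : ℝ) (i : ℕ), i ≤ n →
      ∑ j ∈ Finset.range (n + 1), (if j = i then t else 0) * (j : ℝ) = t * i := by
    intro t i hi
    simp only [ite_mul, zero_mul]
    rw [Finset.sum_ite_eq' (Finset.range (n + 1)) i, if_pos (Finset.mem_range.2 (by omega))]
  -- Weight `θ * m` leaves label `d`, and the unused `θ * (m - 1)` returns at label `c`.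
  refine ⟨fun j => (w j - (if j = d then θ * m else 0) + if j = c then θ * (m - 1) else 0) / (1 - θ),
    ?_, ?_, ?_, ?_⟩
  · intro j
    have : (0 : ℝ) ≤ if j = c then θ * (m - 1) else 0 := by split_ifs <;> simp [ht]
    exact div_nonneg (add_nonneg (hu j) this) hθ1'.le
  · rw [← Finset.sum_div, Finset.sum_add_distrib, Finset.sum_sub_distrib, hsum1 _ d hd,
      hsum1 _ c hcn, h1, div_eq_one_iff_eq hθ1'.ne']
    ring
  · have : ∀ j : ℕ, (w j - (if j = d then θ * m else 0) + if j = c then θ * (m - 1) else 0)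
        / (1 - θ) * (j : ℝ) = (w j * j - (if j = d then θ * m else 0) * (j : ℝ)
          + (if j = c then θ * (m - 1) else 0) * (j : ℝ)) / (1 - θ) := fun j => by ring
    simp only [this]
    rw [← Finset.sum_div, Finset.sum_add_distrib, Finset.sum_sub_distrib, hsum2 _ d hd,
      hsum2 _ c hcn, mul_div_cancel₀ _ hθ1'.ne']
    linear_combination (-θ) * hmean
  · rw [ofReal_smul_labelMixture hθ1'.le]
    have e1 : (fun j : ℕ => (1 - θ) * ((w j - (if j = d then θ * m else 0)
        + if j = c then θ * (m - 1) else 0) / (1 - θ)))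
        = fun j => (w j - if j = d then θ * m else 0) + if j = c then θ * (m - 1) else 0 := by
      funext j; rw [mul_div_cancel₀ _ hθ1'.ne']
    have e2 : w = fun j => (w j - if j = d then θ * m else 0) + if j = d then θ * m else 0 := by
      funext j; ring
    rw [e1, labelMixture_add_single hu ht hcn]
    conv_lhs => rw [e2]
    rw [labelMixture_add_single hu (by positivity) hd, ENNReal.ofReal_mul hθ0,
      ENNReal.ofReal_mul hθ0, mul_smul, mul_smul, hsplit, smul_add]
    abel

/-- Families of label weights with prescribed total mean. -/
structure IsLabelFamily {M : ℕ} (n S : ℕ) (w : Fin M → ℕ → ℝ) : Prop where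
  nonneg : ∀ k j, 0 ≤ w k j
  sum_eq_one : ∀ k, ∑ j ∈ Finset.range (n + 1), w k j = 1
  mean_eq : ∑ k, ∑ j ∈ Finset.range (n + 1), w k j * j = 2 * S

/-- Extreme well charged labels bound the mean up to a small error. -/
theorem exists_charged_labels {n : ℕ} {w : ℕ → ℝ} (h0 : ∀ j, 0 ≤ w j)
    (h1 : ∑ j ∈ Finset.range (n + 1), w j = 1) {ε : ℝ} (hεpos : 0 ≤ ε) (hε : ε * (n + 1) < 1) :
    ∃ a b : ℕ, a ≤ n ∧ b ≤ n ∧ ε ≤ w a ∧ ε ≤ w b ∧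
      (a : ℝ) ≤ ∑ j ∈ Finset.range (n + 1), w j * j + ε * (n + 1) * n ∧
      ∑ j ∈ Finset.range (n + 1), w j * j ≤ b + ε * (n + 1) * n := by
  classical
  -- The labels outside `H` number at most `n + 1`, each with weight at most `ε` and displacement at
  -- most `n`; this gives the error term.
  obtain ⟨H, hH⟩ : ∃ H, H = (Finset.range (n + 1)).filter fun j => ε ≤ w j := ⟨_, rfl⟩
  have hne : H.Nonempty := by
    by_contra hcon
    rw [Finset.not_nonempty_iff_eq_empty, hH, Finset.filter_eq_empty_iff] at hcon
    have : ∑ j ∈ Finset.range (n + 1), w j ≤ ∑ j ∈ Finset.range (n + 1), ε :=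
      Finset.sum_le_sum fun j hj => (not_le.1 (hcon hj)).le
    rw [h1, Finset.sum_const, Finset.card_range, nsmul_eq_mul] at this
    push_cast at this
    linarith
  have hmin := H.min'_mem hne
  have hmax := H.max'_mem hne
  obtain ⟨a, ha⟩ : ∃ a, a = H.min' hne := ⟨_, rfl⟩
  obtain ⟨b, hb⟩ : ∃ b, b = H.max' hne := ⟨_, rfl⟩
  have hamin : ∀ j ∈ H, a ≤ j := fun j hj => ha ▸ H.min'_le j hj
  have hbmax : ∀ j ∈ H, j ≤ b := fun j hj => hb ▸ H.le_max' j hj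
  rw [← ha, hH, Finset.mem_filter, Finset.mem_range] at hmin
  rw [← hb, hH, Finset.mem_filter, Finset.mem_range] at hmax
  have hε0 : ∀ j ∈ Finset.range (n + 1), j ∉ H → w j ≤ ε := by
    intro j hj hjH
    by_contra hcon
    exact hjH (hH ▸ Finset.mem_filter.2 ⟨hj, (not_le.1 hcon).le⟩)
  have han : (a : ℝ) ≤ n := by exact_mod_cast Nat.lt_succ_iff.1 hmin.1
  have hbn : (b : ℝ) ≤ n := by exact_mod_cast Nat.lt_succ_iff.1 hmax.1
  have ha0 : (0 : ℝ) ≤ a := by positivity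
  have hb0 : (0 : ℝ) ≤ b := by positivity
  have hconst : ∑ j ∈ Finset.range (n + 1), ε * n = ε * (n + 1) * n := by
    rw [Finset.sum_const, Finset.card_range, nsmul_eq_mul]; push_cast; ring
  refine ⟨a, b, by omega, by omega, hmin.2, hmax.2, ?_, ?_⟩
  · have : ∑ j ∈ Finset.range (n + 1), w j * (a - j) ≤ ∑ j ∈ Finset.range (n + 1), ε * n := by
      refine Finset.sum_le_sum fun j hj => ?_
      have hj0 : (0 : ℝ) ≤ j := by positivity
      by_cases hjH : j ∈ H
      · have : (a : ℝ) ≤ j := by exact_mod_cast hamin j hjH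
        have := mul_nonneg (h0 j) (sub_nonneg.2 this)
        have : 0 ≤ ε * n := by positivity
        linarith
      · have h := hε0 j hj hjH
        calc w j * (a - j) ≤ w j * n := mul_le_mul_of_nonneg_left (by linarith) (h0 j)
          _ ≤ ε * n := mul_le_mul_of_nonneg_right h (by positivity)
    rw [hconst] at this
    simp only [mul_sub, Finset.sum_sub_distrib, ← Finset.sum_mul, h1] at this
    linarith
  · have : ∑ j ∈ Finset.range (n + 1), w j * (j - b) ≤ ∑ j ∈ Finset.range (n + 1), ε * n := by
      refine Finset.sum_le_sum fun j hj => ?_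
      have hjn : (j : ℝ) ≤ n := by exact_mod_cast Nat.lt_succ_iff.1 (Finset.mem_range.1 hj)
      by_cases hjH : j ∈ H
      · have : (j : ℝ) ≤ b := by exact_mod_cast hbmax j hjH
        have := mul_nonneg (h0 j) (sub_nonneg.2 this)
        have : 0 ≤ ε * n := by positivity
        linarith
      · have h := hε0 j hj hjH
        calc w j * (j - b) ≤ w j * n := mul_le_mul_of_nonneg_left (by linarith) (h0 j)
          _ ≤ ε * n := mul_le_mul_of_nonneg_right h (by positivity)
    rw [hconst] at this
    simp only [mul_sub, Finset.sum_sub_distrib, ← Finset.sum_mul, h1] at this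
    linarith

/-- A definite fraction of a label family whose total mean has enough room is flat, and the rest is
again a label family with the same total mean. -/
theorem IsLabelFamily.exists_peel (M n S : ℕ) (hS : n + M ≤ S) :
    ∃ θ : ℝ, 0 < θ ∧ θ < 1 ∧ ∀ w : Fin M → ℕ → ℝ, IsLabelFamily n S w →
      ∃ (c b : Fin M → ℝ) (w' : Fin M → ℕ → ℝ), (∀ k, 0 ≤ b k) ∧ (∀ k, 2 * b k ≤ ∑ i, b i) ∧
        ∑ i, c i + (∑ i, b i) / 2 = S ∧ IsLabelFamily n S w' ∧
        ∀ k, labelMixture n (w k) = ENNReal.ofReal θ • segmentUniform (c k) (c k + b k)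
          + ENNReal.ofReal (1 - θ) • labelMixture n (w' k) := by
  -- Small enough that the `M` errors from `exists_charged_labels` total less than one, so they
  -- vanish in the integer comparisons with `2 * S`.
  obtain ⟨ε, hε⟩ : ∃ ε : ℝ, ε = 1 / ((M + 2) * (n + 1) * (n + 1)) := ⟨_, rfl⟩
  have hε0 : 0 < ε := by rw [hε]; positivity
  have hM0 : (0 : ℝ) ≤ M := by positivity
  have hn0 : (0 : ℝ) ≤ n := by positivity
  have hε1 : ε * (n + 1) = 1 / ((M + 2) * (n + 1)) := by
    rw [hε]; field_simp
  have hε2 : ε * (n + 1) < 1 := by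
    rw [hε1, div_lt_one (by positivity)]
    nlinarith [mul_nonneg hM0 hn0]
  have hε3 : M * (ε * (n + 1) * n) < 1 := by
    rw [hε1, one_div_mul_eq_div, ← mul_div_assoc, div_lt_one (by positivity)]
    nlinarith [mul_nonneg hM0 hn0]
  obtain ⟨θ, hθ⟩ : ∃ θ, θ = ε / (n + 1) := ⟨_, rfl⟩
  have hθε : θ * (n + 1) = ε := by rw [hθ]; field_simp
  have hθ0 : 0 < θ := by rw [hθ]; positivity
  have hθ1 : θ < 1 := by nlinarith [mul_nonneg hθ0.le hn0, mul_nonneg hε0.le hn0]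
  refine ⟨θ, hθ0, hθ1, fun w hw => ?_⟩
  choose a b ha hb hwa hwb hma hmb using fun k =>
    exists_charged_labels (hw.nonneg k) (hw.sum_eq_one k) hε0.le hε2
  have hsa : ∑ k, a k ≤ 2 * S := by
    have : ∑ k, (a k : ℝ) ≤ ∑ k, (∑ j ∈ Finset.range (n + 1), w k j * j + ε * (n + 1) * n) :=
      Finset.sum_le_sum fun k _ => hma k
    rw [Finset.sum_add_distrib, hw.mean_eq, Finset.sum_const, Finset.card_univ, Fintype.card_fin,
      nsmul_eq_mul] at this
    have h : ((∑ k, a k : ℕ) : ℝ) < (2 * S + 1 : ℕ) := by push_cast; linarith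
    exact Nat.lt_succ_iff.1 (by exact_mod_cast h)
  have hsb : 2 * S ≤ ∑ k, b k := by
    have : ∑ k, ∑ j ∈ Finset.range (n + 1), w k j * j ≤ ∑ k, ((b k : ℝ) + ε * (n + 1) * n) :=
      Finset.sum_le_sum fun k _ => hmb k
    rw [Finset.sum_add_distrib, hw.mean_eq, Finset.sum_const, Finset.card_univ, Fintype.card_fin,
      nsmul_eq_mul] at this
    have h : ((2 * S : ℕ) : ℝ) < (∑ k, b k + 1 : ℕ) := by push_cast; linarith
    exact Nat.lt_succ_iff.1 (by exact_mod_cast h)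
  obtain ⟨d, hdab, hd1, hd2⟩ := exists_mixed_selection a b n (2 * S) hb hsa hsb
  have hdn : ∀ k, d k ≤ n := fun k => by rcases hdab k with h | h <;> rw [h] <;> simp [ha, hb]
  have hwd : ∀ k, ε ≤ w k (d k) := fun k => by
    rcases hdab k with h | h <;> rw [h] <;> simp [hwa, hwb]
  -- The segments `[d k - l k, d k]` have total mean `∑ d - (∑ l) / 2`; requiring this to be `S`
  -- forces `∑ l = 2 * Q`. The room in `hS` gives `M ≤ Q`.
  obtain ⟨Q, hQ⟩ : ∃ Q, ∑ k, d k = S + Q := ⟨∑ k, d k - S, by omega⟩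
  have hQM : M ≤ Q := by omega
  -- The lower bound keeps a segment nondegenerate when its label is positive, as peeling requires;
  -- the upper bound `Q` is the polygon inequality.
  obtain ⟨l, hl, hlsum⟩ := exists_nat_vector_between Finset.univ (fun k => min (d k) 1)
    (fun k => min (d k) Q) (fun k _ => by have := k.pos; show min (d k) 1 ≤ min (d k) Q; omega) (2 * Q)
    (by
      have : ∑ k, min (d k) 1 ≤ ∑ _k : Fin M, 1 := Finset.sum_le_sum fun k _ => min_le_right _ _
      simp at this
      omega)
    (two_mul_le_sum_min d S Q (fun k => (hdn k).trans (by omega)) hQ (by omega))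
  have hl' : ∀ k, min (d k) 1 ≤ l k ∧ l k ≤ min (d k) Q := fun k => hl k (Finset.mem_univ k)
  choose w' h0' h1' hmean' hmix' using fun k => labelMixture_peel (hw.nonneg k) (hw.sum_eq_one k)
    (c := d k - l k) (b := l k) (d := d k) (hdn k) (by have := hl' k; omega)
    (by have := hl' k; omega) hθ0.le hθ1 (by rw [hθε]; exact hwd k)
  have hcast : ∀ k, ((d k - l k : ℕ) : ℝ) = d k - l k := fun k =>
    Nat.cast_sub (by have := hl' k; omega)
  have hQ' : ∑ k, (d k : ℝ) = S + Q := by exact_mod_cast hQ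
  have hl'' : ∑ k, (l k : ℝ) = 2 * Q := by exact_mod_cast hlsum
  refine ⟨fun k => (d k - l k : ℕ), fun k => l k, w', fun k => by positivity, fun k => ?_, ?_,
    ⟨h0', h1', ?_⟩, hmix'⟩
  · rw [hl'']
    have : l k ≤ Q := by have := hl' k; omega
    have : (l k : ℝ) ≤ Q := by exact_mod_cast this
    linarith
  · simp only [hcast, Finset.sum_sub_distrib, hQ', hl'']
    ring
  · have hθ1' : 1 - θ ≠ 0 := by linarith
    apply mul_left_cancel₀ hθ1'
    rw [Finset.mul_sum]
    simp only [hmean', hcast]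
    rw [Finset.sum_sub_distrib, hw.mean_eq, ← Finset.mul_sum, Finset.sum_add_distrib,
      ← Finset.mul_sum, Finset.sum_sub_distrib, hQ', hl'']
    ring

/-! ### Iterating the peeling -/

theorem IsTransportPlan.mix {N : ℕ} {μ ν κ : Fin N → Measure ℝ} {γ γ' : Measure (Fin N → ℝ)}
    (hγ : IsTransportPlan μ γ) (hγ' : IsTransportPlan ν γ') {θ : ℝ} (h0 : 0 ≤ θ) (h1 : θ ≤ 1)
    (hκ : ∀ k, κ k = ENNReal.ofReal θ • μ k + ENNReal.ofReal (1 - θ) • ν k) :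
    IsTransportPlan κ (ENNReal.ofReal θ • γ + ENNReal.ofReal (1 - θ) • γ') := by
  have := hγ.isProbabilityMeasure
  have := hγ'.isProbabilityMeasure
  refine ⟨⟨?_⟩, fun k => ?_⟩
  · simp only [Measure.add_apply, Measure.smul_apply, measure_univ, smul_eq_mul, mul_one]
    rw [← ENNReal.ofReal_add h0 (by linarith)]
    simp
  · rw [Measure.map_add _ _ (measurable_pi_apply k), Measure.map_smul, Measure.map_smul,
      hγ.map_eval, hγ'.map_eval, hκ]

theorem isTransportPlan_pi {N : ℕ} (μ : Fin N → Measure ℝ) (hμ : ∀ k, IsProbabilityMeasure (μ k)) :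
    IsTransportPlan μ (Measure.pi μ) :=
  ⟨inferInstance, fun k => by
    simpa using (measurePreserving_eval μ k).map_eq⟩

/-- Label families whose total mean has enough room admit couplings whose sum is constant up to an
event of arbitrarily small probability. -/
theorem IsLabelFamily.exists_almost_flat {M n S : ℕ} (hS : n + M ≤ S) {w : Fin M → ℕ → ℝ}
    (hw : IsLabelFamily n S w) {ε : ℝ} (hε : 0 < ε) :
    ∃ γ : Measure (Fin M → ℝ), IsTransportPlan (fun k => labelMixture n (w k)) γ ∧
      γ {x | ∑ i, x i ≠ S} ≤ ENNReal.ofReal ε := by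
  obtain ⟨θ, hθ0, hθ1, hpeel⟩ := IsLabelFamily.exists_peel M n S hS
  have key : ∀ (m : ℕ) (w : Fin M → ℕ → ℝ), IsLabelFamily n S w →
      ∃ γ : Measure (Fin M → ℝ), IsTransportPlan (fun k => labelMixture n (w k)) γ ∧
        γ {x | ∑ i, x i ≠ S} ≤ ENNReal.ofReal ((1 - θ) ^ m) := by
    intro m
    induction m with
    | zero =>
      intro w hw
      have hp := fun k => labelMixture_isProbabilityMeasure (hw.nonneg k) (hw.sum_eq_one k)
      exact ⟨_, isTransportPlan_pi _ hp, by simpa using prob_le_one⟩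
    | succ m ih =>
      intro w hw
      obtain ⟨c, b, w', hb0, hb, hcb, hw', hmix⟩ := hpeel w hw
      obtain ⟨γ, hγ, hγS⟩ := exists_coupling_segmentUniform c b hb0 hb
      obtain ⟨γ', hγ', hγS'⟩ := ih w' hw'
      rw [hcb] at hγS
      -- Only the remainder, of weight `1 - θ`, can miss the hyperplane.
      refine ⟨_, hγ.mix hγ' hθ0.le hθ1.le hmix, ?_⟩
      have hγ0 : γ {x | ∑ i, x i ≠ S} = 0 := hγS
      rw [Measure.add_apply, Measure.smul_apply, Measure.smul_apply, hγ0, smul_zero, zero_add,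
        pow_succ', ENNReal.ofReal_mul (by linarith), smul_eq_mul]
      gcongr
  obtain ⟨m, hm⟩ := exists_pow_lt_of_lt_one hε (by linarith : 1 - θ < 1)
  obtain ⟨γ, hγ, hγS⟩ := key m w hw
  exact ⟨γ, hγ, hγS.trans (ENNReal.ofReal_le_ofReal hm.le)⟩

/-! ### Discretizing a decreasing density -/

theorem segmentUniform_ae_mem {c d : ℝ} (h : c ≤ d) :
    ∀ᵐ x ∂segmentUniform c d, x ∈ Set.Icc c d := by
  rw [segmentUniform, ae_map_iff (p := fun x => x ∈ Set.Icc c d) (by fun_prop) measurableSet_Icc]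
  filter_upwards [ae_restrict_mem measurableSet_Icc] with v hv
  constructor <;> nlinarith [hv.1, hv.2]

theorem labelMixture_ae_mem {n T : ℕ} {w : ℕ → ℝ} (hT : ∀ j ≤ n, T < j → w j = 0) :
    ∀ᵐ x ∂labelMixture n w, x ∈ Set.Icc (0 : ℝ) T := by
  have : ∀ j ∈ Finset.range (n + 1),
      (ENNReal.ofReal (w j) • segmentUniform 0 j) (Set.Icc (0 : ℝ) T)ᶜ = 0 := by
    intro j hj
    by_cases hjT : T < j
    · simp [hT j (by simpa [Nat.lt_succ_iff] using hj) hjT]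
    · have h : ∀ᵐ x ∂segmentUniform 0 j, x ∈ Set.Icc (0 : ℝ) T := by
        filter_upwards [segmentUniform_ae_mem (Nat.cast_nonneg j)] with x hx
        exact ⟨hx.1, hx.2.trans (by exact_mod_cast not_lt.1 hjT)⟩
      have h' : segmentUniform 0 j (Set.Icc (0 : ℝ) T)ᶜ = 0 := h
      simp [h']
  change labelMixture n w (Set.Icc (0 : ℝ) T)ᶜ = 0
  rw [labelMixture, Measure.coe_finsetSum, Finset.sum_apply]
  exact Finset.sum_eq_zero this

/-- Summation by parts: a decreasing step function is a stack of horizontal layers, each uniform on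
some `[0, j]`. -/
theorem sum_smul_segmentUniform (q : ℕ → ℝ) (hq0 : ∀ j, 0 ≤ q j) (hq : ∀ j, q (j + 1) ≤ q j) (n : ℕ) :
    ∑ i ∈ Finset.range n, ENNReal.ofReal ((i + 1) * (q i - q (i + 1))) • segmentUniform 0 (i + 1)
      + ENNReal.ofReal (n * q n) • segmentUniform 0 n
      = ∑ i ∈ Finset.range n, ENNReal.ofReal (q i) • segmentUniform i (i + 1) := by
  induction n with
  | zero => simp
  | succ n ih =>
    rw [Finset.sum_range_succ, Finset.sum_range_succ, ← ih, add_assoc, add_assoc]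
    congr 1
    have hn : (0 : ℝ) ≤ n + 1 := by positivity
    push_cast
    rw [← add_smul, ← ENNReal.ofReal_add (mul_nonneg hn (sub_nonneg.2 (hq n)))
      (mul_nonneg hn (hq0 _)),
      show ((n : ℝ) + 1) * (q n - q (n + 1)) + (n + 1) * q (n + 1) = q n * (n + 1 - 0) by ring,
      ENNReal.ofReal_mul (hq0 n), mul_smul,
      ofReal_smul_segmentUniform_split (Nat.cast_nonneg n) (by linarith : (n : ℝ) ≤ n + 1),
      smul_add, smul_smul, ← ENNReal.ofReal_mul (hq0 n)]
    simp [mul_comm]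

/-- Each cell contributes an error of at most `δ` times its mass, and the masses add up to one. -/
theorem abs_integral_sub_sum_cells_le (μ : Measure ℝ) [IsProbabilityMeasure μ] {h : ℝ}
    {n : ℕ} (hsupp : μ (Set.Ico 0 (n * h))ᶜ = 0) (hh : 0 < h)
    {f : ℝ → ℝ} (hf : Integrable f μ) (a : ℕ → ℝ) {δ : ℝ}
    (ha : ∀ i < n, ∀ x ∈ Set.Ico (i * h) ((i + 1) * h), |f x - a i| ≤ δ) :
    |∫ x, f x ∂μ - ∑ i ∈ Finset.range n, μ.real (Set.Ico (i * h) ((i + 1) * h)) * a i| ≤ δ := by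
  have hcells : ⋃ i ∈ Finset.range n, Set.Ico ((i : ℝ) * h) ((i + 1) * h) = Set.Ico 0 (n * h) := by
    ext x
    simp only [Set.mem_iUnion, Finset.mem_range, Set.mem_Ico, exists_prop]
    constructor
    · rintro ⟨i, hi, h1, h2⟩
      have : ((i : ℝ) + 1) ≤ n := by exact_mod_cast hi
      exact ⟨le_trans (by positivity) h1, h2.trans_le (mul_le_mul_of_nonneg_right this hh.le)⟩
    · rintro ⟨h1, h2⟩
      have hx : 0 ≤ x / h := by positivity
      refine ⟨⌊x / h⌋₊, ?_, ?_, ?_⟩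
      · rw [Nat.floor_lt hx, div_lt_iff₀ hh]; exact h2
      · rw [← le_div_iff₀ hh]; exact Nat.floor_le hx
      · rw [← div_lt_iff₀ hh]; exact Nat.lt_floor_add_one _
  have hdisj : Set.Pairwise (↑(Finset.range n))
      (Function.onFun Disjoint fun i : ℕ => Set.Ico ((i : ℝ) * h) ((i + 1) * h)) := by
    have key : ∀ i j : ℕ, i < j → Disjoint (Set.Ico ((i : ℝ) * h) ((i + 1) * h))
        (Set.Ico ((j : ℝ) * h) ((j + 1) * h)) := by
      intro i j hij
      have : ((i : ℝ) + 1) ≤ j := by exact_mod_cast hij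
      exact Set.disjoint_left.2 fun x hx hx' =>
        not_lt.2 ((mul_le_mul_of_nonneg_right this hh.le).trans hx'.1) hx.2
    intro i _ j _ hij
    rcases lt_or_gt_of_ne hij with h' | h'
    · exact key i j h'
    · exact (key j i h').symm
  have hrestr : μ = μ.restrict (Set.Ico 0 (n * h)) :=
    (Measure.restrict_eq_self_of_ae_mem hsupp).symm
  have hint : ∀ g : ℝ → ℝ, Integrable g μ → ∫ x, g x ∂μ
      = ∑ i ∈ Finset.range n, ∫ x in Set.Ico ((i : ℝ) * h) ((i + 1) * h), g x ∂μ := by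
    intro g hg
    conv_lhs => rw [hrestr, ← hcells]
    exact integral_biUnion_finset _ (fun _ _ => measurableSet_Ico) hdisj
      fun _ _ => hg.integrableOn
  have hmass : ∑ i ∈ Finset.range n, μ.real (Set.Ico ((i : ℝ) * h) ((i + 1) * h)) = 1 := by
    have := hint (fun _ => 1) (integrable_const 1)
    simpa using this.symm
  rw [hint f hf, ← Finset.sum_sub_distrib]
  calc _ ≤ ∑ i ∈ Finset.range n, |∫ x in Set.Ico ((i : ℝ) * h) ((i + 1) * h), f x ∂μ
          - μ.real (Set.Ico ((i : ℝ) * h) ((i + 1) * h)) * a i| := Finset.abs_sum_le_sum_abs _ _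
    _ ≤ ∑ i ∈ Finset.range n, δ * μ.real (Set.Ico ((i : ℝ) * h) ((i + 1) * h)) := by
        refine Finset.sum_le_sum fun i hi => ?_
        have e : ∫ x in Set.Ico ((i : ℝ) * h) ((i + 1) * h), f x ∂μ
            - μ.real (Set.Ico ((i : ℝ) * h) ((i + 1) * h)) * a i
            = ∫ x in Set.Ico ((i : ℝ) * h) ((i + 1) * h), (f x - a i) ∂μ := by
          rw [integral_sub hf.integrableOn (integrable_const _)]
          simp
        rw [e, ← Real.norm_eq_abs]
        exact norm_setIntegral_le_of_norm_le_const (measure_lt_top _ _)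
          fun x hx => ha i (Finset.mem_range.1 hi) x hx
    _ = δ := by rw [← Finset.mul_sum, hmass, mul_one]

/-- Discretization of a distribution with decreasing density. -/
theorem exists_label_approximation (μ : Measure ℝ) [IsProbabilityMeasure μ] {h : ℝ} (hh : 0 < h)
    {n : ℕ} (hsupp : μ (Set.Ico 0 (n * h))ᶜ = 0)
    (hanti : ∀ j : ℕ, μ (Set.Ico ((j + 1 : ℕ) * h) (((j + 1 : ℕ) + 1) * h))
      ≤ μ (Set.Ico (j * h) ((j + 1) * h))) :
    ∃ w : ℕ → ℝ, (∀ j, 0 ≤ w j) ∧ ∑ j ∈ Finset.range (n + 1), w j = 1 ∧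
      |2 * ∫ x, x ∂μ - h * ∑ j ∈ Finset.range (n + 1), w j * j| ≤ 2 * h ∧
      ∀ (f : ℝ → ℝ) (L : NNReal), LipschitzWith L f →
        |∫ x, f x ∂μ - ∫ x, f (h * x) ∂labelMixture n w| ≤ L * h := by
  obtain ⟨q, hq⟩ : ∃ q : ℕ → ℝ, q = fun j : ℕ => μ.real (Set.Ico (j * h) ((j + 1) * h)) := ⟨_, rfl⟩
  have hq0 : ∀ j, 0 ≤ q j := fun j => by rw [hq]; exact measureReal_nonneg
  have hqa : ∀ j, q (j + 1) ≤ q j := fun j => by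
    rw [hq]; exact ENNReal.toReal_mono (measure_ne_top _ _) (hanti j)
  have hqn : q n = 0 := by
    rw [hq, measureReal_eq_zero_iff]
    refine measure_mono_null (t := (Set.Ico 0 (n * h))ᶜ) (fun x hx hx' => ?_) hsupp
    exact not_lt.2 hx.1 hx'.2
  have hbox : ∀ᵐ x ∂μ, x ∈ Set.Icc (0 : ℝ) (n * h) := by
    have : ∀ᵐ x ∂μ, x ∈ Set.Ico (0 : ℝ) (n * h) := hsupp
    filter_upwards [this] with x hx using Set.Ico_subset_Icc_self hx
  have hint : ∀ g : ℝ → ℝ, Continuous g → Integrable g μ := by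
    intro g hg
    have : IntegrableOn g (Set.Icc 0 (n * h)) μ := hg.continuousOn.integrableOn_Icc
    rwa [IntegrableOn, Measure.restrict_eq_self_of_ae_mem hbox] at this
  -- Layer `j` has height equal to the drop of cell mass at `j`. At `j = 0` the truncated index is
  -- harmless because of the factor `j`.
  obtain ⟨w, hw⟩ : ∃ w : ℕ → ℝ, w = fun j : ℕ => j * (q (j - 1) - q j) := ⟨_, rfl⟩
  have hw0 : w 0 = 0 := by simp [hw]
  have hws : ∀ j, w (j + 1) = (j + 1) * (q j - q (j + 1)) := fun j => by simp [hw]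
  have hmix : labelMixture n w
      = ∑ i ∈ Finset.range n, ENNReal.ofReal (q i) • segmentUniform i (i + 1) := by
    rw [← sum_smul_segmentUniform q hq0 hqa n, labelMixture, Finset.sum_range_succ']
    simp [hw0, hws, hqn]
  have abel1 : ∀ m : ℕ, ∑ i ∈ Finset.range m, ((i : ℝ) + 1) * (q i - q (i + 1))
      = ∑ i ∈ Finset.range m, q i - m * q m := by
    intro m
    induction m with
    | zero => simp
    | succ m ih => rw [Finset.sum_range_succ, Finset.sum_range_succ, ih]; push_cast; ring
  have abel2 : ∀ m : ℕ, ∑ i ∈ Finset.range m, ((i : ℝ) + 1) * (q i - q (i + 1)) * (i + 1)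
      = ∑ i ∈ Finset.range m, q i * (2 * i + 1) - m * m * q m := by
    intro m
    induction m with
    | zero => simp
    | succ m ih => rw [Finset.sum_range_succ, Finset.sum_range_succ, ih]; push_cast; ring
  have hqsum : ∑ i ∈ Finset.range n, q i = 1 := by
    have := abs_integral_sub_sum_cells_le μ hsupp hh (integrable_const (1 : ℝ)) (fun _ => 1)
      (δ := 0) (by simp)
    rw [abs_nonpos_iff, sub_eq_zero] at this
    simpa [hq] using this.symm
  refine ⟨w, ?_, ?_, ?_, ?_⟩
  · intro j
    cases j with
    | zero => rw [hw0]
    | succ j => rw [hws]; exact mul_nonneg (by positivity) (sub_nonneg.2 (hqa j))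
  · rw [Finset.sum_range_succ', hw0]
    simp only [hws]
    rw [abel1, hqn, hqsum]; simp
  · rw [Finset.sum_range_succ', hw0]
    simp only [hws]
    push_cast
    rw [abel2, hqn]
    -- The label mean is `∑ q i * (2 * i + 1)`: twice the mean, in units of `h`, with each cell's
    -- mass moved to its midpoint.
    have := abs_integral_sub_sum_cells_le μ hsupp hh (hint _ continuous_id)
      (fun i => h * (2 * i + 1) / 2) (δ := h) (fun i _ x hx => by
        rw [abs_le]; simp only [id]; constructor <;> nlinarith [hx.1, hx.2])
    have e : 2 * ∫ x, x ∂μ - h * (∑ i ∈ Finset.range n, q i * (2 * (i : ℝ) + 1) - n * n * 0 + 0 * 0)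
        = 2 * (∫ x, id x ∂μ - ∑ i ∈ Finset.range n, μ.real (Set.Ico (i * h) ((i + 1) * h))
          * (h * (2 * i + 1) / 2)) := by
      rw [mul_sub, Finset.mul_sum, mul_zero, mul_zero, sub_zero, add_zero, Finset.mul_sum]
      congr 1
      refine Finset.sum_congr rfl fun i _ => ?_
      rw [hq]; ring
    rw [e, abs_mul, abs_two]
    linarith
  · intro f L hf
    have hfc := hf.continuous
    have hfh : Continuous fun x => f (h * x) := by fun_prop
    have hseg : ∀ i : ℕ, Integrable (fun x => f (h * x)) (segmentUniform i (i + 1)) := by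
      intro i
      have : IntegrableOn (fun x => f (h * x)) (Set.Icc (i : ℝ) (i + 1))
        (segmentUniform i (i + 1)) := hfh.continuousOn.integrableOn_Icc
      rwa [IntegrableOn, Measure.restrict_eq_self_of_ae_mem
        (segmentUniform_ae_mem (by linarith))] at this
    have hI : ∫ x, f (h * x) ∂labelMixture n w
        = ∑ i ∈ Finset.range n, μ.real (Set.Ico (i * h) ((i + 1) * h))
          * ∫ x, f (h * x) ∂segmentUniform i (i + 1) := by
      rw [hmix, integral_finsetSum_measure fun i _ => (hseg i).smul_measure ENNReal.ofReal_ne_top]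
      refine Finset.sum_congr rfl fun i _ => ?_
      rw [integral_smul_measure, ENNReal.toReal_ofReal (hq0 i), smul_eq_mul, hq]
    rw [hI]
    refine abs_integral_sub_sum_cells_le μ hsupp hh (hint f hfc) _ fun i _ x hx => ?_
    have e : f x - ∫ y, f (h * y) ∂segmentUniform i (i + 1)
        = ∫ y, (f x - f (h * y)) ∂segmentUniform i (i + 1) := by
      rw [integral_sub (integrable_const _) (hseg i)]; simp
    rw [e, ← Real.norm_eq_abs]
    refine (norm_integral_le_of_norm_le_const (C := L * h) ?_).trans (by simp)
    filter_upwards [segmentUniform_ae_mem (by linarith : (i : ℝ) ≤ i + 1)] with y hy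
    have h1 := hf.dist_le_mul x (h * y)
    rw [Real.dist_eq, Real.dist_eq] at h1
    rw [Real.norm_eq_abs]
    refine h1.trans (mul_le_mul_of_nonneg_left ?_ L.coe_nonneg)
    rw [abs_le]
    constructor <;> nlinarith [hx.1, hx.2, hy.1, hy.2]

/-! ### Compactness, and the limit of almost flat couplings -/

open Filter Topology in
/-- Limits of almost flat couplings. -/
theorem exists_flat_of_tendsto {N : ℕ} (μ : Fin N → Measure ℝ)
    (hμ : ∀ k, IsProbabilityMeasure (μ k)) (R C : ℝ) (γ : ℕ → Measure (Fin N → ℝ))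
    (hγ : ∀ n, IsProbabilityMeasure (γ n))
    (hbox : ∀ n, γ n (Set.Icc 0 fun _ => R)ᶜ = 0)
    (hmarg : ∀ k (f : ℝ → ℝ) (L : NNReal), LipschitzWith L f →
      Tendsto (fun n => ∫ x, f (x k) ∂γ n) atTop (𝓝 (∫ x, f x ∂μ k)))
    (hsum : Tendsto (fun n => ∫ x, min |∑ i, x i - C| 1 ∂γ n) atTop (𝓝 0)) :
    ∃ γ : Measure (Fin N → ℝ), IsTransportPlan μ γ ∧ ConcentratedOnHyperplane γ C := by
  have hcpt := isCompact_setOfPred_probabilityMeasure_mass_eq_compl_isCompact_le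
    (E := Fin N → ℝ) (u := fun _ => 0) (K := fun _ => Set.Icc 0 fun _ => R) tendsto_const_nhds
    (fun _ => isCompact_Icc) (Or.inl inferInstance)
  obtain ⟨Γ, hΓ⟩ : ∃ Γ : ℕ → ProbabilityMeasure (Fin N → ℝ), ∀ n, (Γ n : Measure _) = γ n :=
    ⟨fun n => ⟨γ n, hγ n⟩, fun _ => rfl⟩
  obtain ⟨γ', -, φ, hφ, hlim⟩ := hcpt.isSeqCompact (x := Γ) (fun n m => by
    rw [← ENNReal.coe_le_coe, ProbabilityMeasure.ennreal_coeFn_eq_coeFn_toMeasure, hΓ, hbox n]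
    simp)
  refine ⟨γ', ⟨inferInstance, fun k => ?_⟩, ?_⟩
  · have h1 := ProbabilityMeasure.tendsto_map_of_tendsto_of_continuous _ _ hlim
      (continuous_apply (A := fun _ : Fin N => ℝ) k)
    obtain ⟨ν, hν⟩ : ∃ ν : ProbabilityMeasure ℝ, (ν : Measure ℝ) = μ k := ⟨⟨μ k, hμ k⟩, rfl⟩
    have h2 : Tendsto (fun n => (Γ (φ n)).map
        (continuous_apply (A := fun _ : Fin N => ℝ) k).measurable.aemeasurable) atTop (𝓝 ν) := by
      -- Lipschitz test functions determine weak convergence, hence the marginals of the limit.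
      rw [tendsto_iff_forall_lipschitz_integral_tendsto]
      rintro f - ⟨L, hL⟩
      have := (hmarg k f L hL).comp hφ.tendsto_atTop
      rw [hν]
      refine this.congr fun n => ?_
      rw [Function.comp_apply, ProbabilityMeasure.toMeasure_map, hΓ]
      rw [integral_map (measurable_pi_apply k).aemeasurable hL.continuous.aestronglyMeasurable]
    have h3 := tendsto_nhds_unique h1 h2
    have h4 := congrArg (fun ν : ProbabilityMeasure ℝ => (ν : Measure ℝ)) h3
    rw [ProbabilityMeasure.toMeasure_map, hν] at h4
    exact h4
  -- The truncation makes the defect a bounded continuous function, so its zero integral passes to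
  -- the weak limit.
  · have hcont : Continuous fun x : Fin N → ℝ => min |∑ i, x i - C| 1 := by fun_prop
    have hbd : ∀ x : Fin N → ℝ, ‖min |∑ i, x i - C| 1‖ ≤ 1 := fun x => by
      rw [Real.norm_eq_abs, abs_of_nonneg (le_min (abs_nonneg _) zero_le_one)]
      exact min_le_right _ _
    have h1 := (ProbabilityMeasure.tendsto_iff_forall_integral_tendsto.1 hlim)
      (BoundedContinuousFunction.ofNormedAddCommGroup _ hcont 1 hbd)
    have h2 := tendsto_nhds_unique h1 ((hsum.comp hφ.tendsto_atTop).congr fun n => by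
      rw [Function.comp_apply, Function.comp_apply, hΓ]; rfl)
    have h3 : ∫ x : Fin N → ℝ, min |∑ i, x i - C| 1 ∂(γ' : Measure (Fin N → ℝ)) = 0 := h2
    rw [integral_eq_zero_iff_of_nonneg (fun x => le_min (abs_nonneg _) zero_le_one)
      (Integrable.of_bound hcont.aestronglyMeasurable 1 (Eventually.of_forall hbd))] at h3
    filter_upwards [h3] with x hx
    have hx' : min |∑ i, x i - C| 1 = 0 := hx
    rcases min_choice |∑ i, x i - C| 1 with h | h
    · rw [h, abs_eq_zero, sub_eq_zero] at hx'
      exact hx'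
    · rw [h] at hx'; exact absurd hx' one_ne_zero

/-- An almost flat coupling at scale `S / n`. -/
theorem exists_almost_flat_coupling {N : ℕ} (μ : Fin N → Measure ℝ)
    (hμ : ∀ k, IsProbabilityMeasure (μ k)) {S : ℝ} (hS : 0 < S)
    (hsupp : ∀ k, μ k (Set.Ico 0 S)ᶜ = 0)
    (hanti : ∀ k, ∀ h > 0, ∀ j : ℕ, μ k (Set.Ico ((j + 1 : ℕ) * h) (((j + 1 : ℕ) + 1) * h))
      ≤ μ k (Set.Ico (j * h) ((j + 1) * h)))
    (hmean : ∑ k, ∫ x, x ∂μ k = S) {n : ℕ} (hn : 6 * N + 2 ≤ n) :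
    ∃ γ : Measure (Fin N → ℝ), IsProbabilityMeasure γ ∧ γ (Set.Icc 0 fun _ => S)ᶜ = 0 ∧
      (∀ k (f : ℝ → ℝ) (L : NNReal), LipschitzWith L f →
        |∫ x, f x ∂μ k - ∫ x, f (x k) ∂γ| ≤ L * (S / n)) ∧
      ∫ x, min |∑ i, x i - S| 1 ∂γ ≤ (6 * N + 2) * (S / n) + 1 / n := by
  have hn0 : (0 : ℝ) < n := by exact_mod_cast (by omega : 0 < n)
  obtain ⟨h, hh⟩ : ∃ h, h = S / n := ⟨_, rfl⟩
  have hpos : 0 < h := by rw [hh]; positivity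
  have hnh : n * h = S := by rw [hh]; field_simp
  rw [← hh]
  choose w hw0 hw1 hwm hwf using fun k => exists_label_approximation (μ k) hpos (n := n)
    (by rw [hnh]; exact hsupp k) (hanti k h hpos)
  -- Since `|σ| ≤ 2 * N`, the auxiliary label mean `4 * N + 2 - σ` lies between `0` and `t`. It
  -- brings the total to `2 * (n + 2 * N + 1)`, with enough room for `N + 1` coordinates.
  obtain ⟨t, ht⟩ : ∃ t : ℕ, t = 6 * N + 2 := ⟨_, rfl⟩
  have ht0 : (0 : ℝ) < t := by exact_mod_cast (by omega : 0 < t)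
  have htr : (t : ℝ) = 6 * N + 2 := by exact_mod_cast ht
  obtain ⟨σ, hσ⟩ : ∃ σ : ℝ, σ = ∑ k, ∑ j ∈ Finset.range (n + 1), w k j * j - 2 * n := ⟨_, rfl⟩
  have hσN : |σ| ≤ 2 * N := by
    have h1 : |∑ k, (2 * ∫ x, x ∂μ k - h * ∑ j ∈ Finset.range (n + 1), w k j * j)| ≤ N * (2 * h) := by
      refine (Finset.abs_sum_le_sum_abs _ _).trans ((Finset.sum_le_sum fun k _ => hwm k).trans ?_)
      simp
    rw [Finset.sum_sub_distrib, ← Finset.mul_sum, ← Finset.mul_sum, hmean] at h1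
    have h2 : 2 * S - h * ∑ k, ∑ j ∈ Finset.range (n + 1), w k j * j = h * (-σ) := by
      rw [hσ, ← hnh]; ring
    rw [h2, abs_mul, abs_neg, abs_of_pos hpos] at h1
    have : h * |σ| ≤ h * (2 * N) := by linarith
    exact le_of_mul_le_mul_left this hpos
  rw [abs_le] at hσN
  have hN0 : (0 : ℝ) ≤ N := by positivity
  -- an auxiliary variable absorbs the rounding of the means
  obtain ⟨p, hp⟩ : ∃ p : ℝ, p = (4 * N + 2 - σ) / t := ⟨_, rfl⟩
  have hp0 : 0 ≤ p := by rw [hp]; apply div_nonneg <;> linarith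
  have hp1 : p ≤ 1 := by rw [hp, div_le_one ht0]; linarith
  have hpt : p * t = 4 * N + 2 - σ := by rw [hp]; field_simp
  obtain ⟨v, hv⟩ : ∃ v : ℕ → ℝ,
      v = fun j => (if j = 0 then 1 - p else 0) + if j = t then p else 0 := ⟨_, rfl⟩
  have hfam : IsLabelFamily n (n + 2 * N + 1) (Fin.snoc w v : Fin (N + 1) → ℕ → ℝ) := by
    refine ⟨fun k => ?_, fun k => ?_, ?_⟩
    · refine Fin.lastCases ?_ (fun k => ?_) k
      · intro j
        rw [Fin.snoc_last, hv]
        apply add_nonneg <;> split_ifs <;> linarith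
      · rw [Fin.snoc_castSucc]; exact hw0 k
    · refine Fin.lastCases ?_ (fun k => ?_) k
      · rw [Fin.snoc_last, hv, Finset.sum_add_distrib, Finset.sum_ite_eq' _ 0,
          Finset.sum_ite_eq' _ t, if_pos (Finset.mem_range.2 (by omega)),
          if_pos (Finset.mem_range.2 (by omega))]
        ring
      · rw [Fin.snoc_castSucc]; exact hw1 k
    · rw [Fin.sum_univ_castSucc]
      simp only [Fin.snoc_castSucc, Fin.snoc_last]
      have : ∑ j ∈ Finset.range (n + 1), v j * (j : ℝ) = p * t := by
        simp only [hv, add_mul, ite_mul, zero_mul, Finset.sum_add_distrib]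
        rw [Finset.sum_ite_eq' _ 0, Finset.sum_ite_eq' _ t, if_pos (Finset.mem_range.2 (by omega)),
          if_pos (Finset.mem_range.2 (by omega))]
        simp
      rw [this, hpt, hσ]
      push_cast
      ring
  obtain ⟨γ, hγ, hγS⟩ := hfam.exists_almost_flat (by omega) (ε := 1 / n) (by positivity)
  have hγp := hγ.isProbabilityMeasure
  have hm : Measurable (fun (x : Fin (N + 1) → ℝ) (k : Fin N) => h * x k.castSucc) :=
    measurable_pi_lambda _ fun k => by fun_prop
  have hcoord : ∀ k : Fin (N + 1), ∀ T : ℕ,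
      (∀ j ≤ n, T < j → (Fin.snoc w v : Fin (N + 1) → ℕ → ℝ) k j = 0) →
      ∀ᵐ x ∂γ, x k ∈ Set.Icc (0 : ℝ) T := by
    intro k T hT
    have := labelMixture_ae_mem hT
    rw [← hγ.map_eval k] at this
    exact ae_of_ae_map (measurable_pi_apply k).aemeasurable this
  have hlast : ∀ᵐ x ∂γ, x (Fin.last N) ∈ Set.Icc (0 : ℝ) t := by
    refine hcoord _ _ fun j _ hj => ?_
    rw [Fin.snoc_last, hv]
    have h0 : j ≠ 0 := by omega
    have h1 : j ≠ t := by omega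
    simp [h0, h1]
  refine ⟨γ.map fun x k => h * x k.castSucc, Measure.isProbabilityMeasure_map hm.aemeasurable,
    ?_, ?_, ?_⟩
  · rw [Measure.map_apply hm measurableSet_Icc.compl]
    have hall : ∀ᵐ x ∂γ, ∀ k : Fin N, x k.castSucc ∈ Set.Icc (0 : ℝ) n :=
      ae_all_iff.2 fun k => hcoord _ _ fun j hj hj' => absurd hj (not_le.2 hj')
    have : ∀ᵐ x ∂γ, (fun k : Fin N => h * x k.castSucc) ∈ Set.Icc (0 : Fin N → ℝ) fun _ => S := by
      filter_upwards [hall] with x hx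
      refine ⟨fun k => mul_nonneg hpos.le (hx k).1, fun k => ?_⟩
      change h * x k.castSucc ≤ S
      rw [← hnh, mul_comm]
      exact mul_le_mul_of_nonneg_right (hx k).2 hpos.le
    exact this
  · intro k f L hf
    have hfc := hf.continuous
    have hfk : Continuous fun x : Fin N → ℝ => f (x k) := hfc.comp (continuous_apply k)
    rw [integral_map hm.aemeasurable hfk.aestronglyMeasurable]
    have := hwf k f L hf
    have e := hγ.map_eval k.castSucc
    simp only [Fin.snoc_castSucc] at e
    rw [← e, integral_map (measurable_pi_apply _).aemeasurable (by fun_prop)] at this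
    exact this
  · rw [integral_map hm.aemeasurable (by fun_prop)]
    obtain ⟨B, hB⟩ : ∃ B : Set (Fin (N + 1) → ℝ), B = {x | ∑ i, x i ≠ ((n + 2 * N + 1 : ℕ) : ℝ)} := ⟨_, rfl⟩
    rw [← hB] at hγS
    have hBm : MeasurableSet B := by
      rw [hB]
      exact (measurableSet_eq_fun (by fun_prop) (by fun_prop)).compl
    -- Off `B` the defect is `h * |2 * N + 1 - x (Fin.last N)|`, at most `t * h`; on `B` the
    -- truncation bounds it by one.
    have hle : ∀ᵐ x ∂γ, min |∑ i : Fin N, h * x i.castSucc - S| 1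
        ≤ t * h + B.indicator (fun _ => 1) x := by
      filter_upwards [hlast] with x hx
      by_cases hxB : x ∈ B
      · rw [Set.indicator_of_mem hxB]
        exact (min_le_right _ _).trans (by nlinarith)
      · rw [Set.indicator_of_notMem hxB, add_zero]
        refine (min_le_left _ _).trans ?_
        rw [hB] at hxB
        simp only [Set.mem_ofPred_eq, not_not] at hxB
        rw [Fin.sum_univ_castSucc] at hxB
        push_cast at hxB
        have e : ∑ i : Fin N, h * x i.castSucc - S = h * (2 * N + 1 - x (Fin.last N)) := by
          rw [← Finset.mul_sum, ← hnh]
          linear_combination h * hxB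
        rw [e, abs_mul, abs_of_pos hpos, mul_comm]
        refine mul_le_mul_of_nonneg_right ?_ hpos.le
        rw [abs_le]
        constructor <;> linarith [hx.1, hx.2]
    have hint : Integrable (fun x => t * h + B.indicator (fun _ => (1 : ℝ)) x) γ :=
      (integrable_const _).add ((integrable_const _).indicator hBm)
    have := integral_mono_of_nonneg (Filter.Eventually.of_forall fun x =>
      le_min (abs_nonneg _) zero_le_one) hint hle
    refine this.trans ?_
    rw [integral_add (integrable_const _) ((integrable_const _).indicator hBm),
      integral_indicator_const _ hBm]
    simp only [integral_const, probReal_univ, smul_eq_mul, one_mul, mul_one]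
    rw [htr]
    have : γ.real B ≤ 1 / n := ENNReal.toReal_le_of_le_ofReal (by positivity) hγS
    linarith

/-- Distributions on `[0, S)` with decreasing densities whose means add up to `S` are flat. -/
theorem exists_flat_of_decreasing {N : ℕ} (μ : Fin N → Measure ℝ)
    (hμ : ∀ k, IsProbabilityMeasure (μ k)) {S : ℝ} (hS : 0 < S)
    (hsupp : ∀ k, μ k (Set.Ico 0 S)ᶜ = 0)
    (hanti : ∀ k, ∀ h > 0, ∀ j : ℕ, μ k (Set.Ico ((j + 1 : ℕ) * h) (((j + 1 : ℕ) + 1) * h))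
      ≤ μ k (Set.Ico (j * h) ((j + 1) * h)))
    (hmean : ∑ k, ∫ x, x ∂μ k = S) :
    ∃ γ : Measure (Fin N → ℝ), IsTransportPlan μ γ ∧ ConcentratedOnHyperplane γ S := by
  choose γ hγ hbox hmarg hsum using fun m : ℕ =>
    exists_almost_flat_coupling μ hμ hS hsupp hanti hmean (n := m + (6 * N + 2)) (by omega)
  have hlim : ∀ a : ℝ, Filter.Tendsto (fun m : ℕ => a / ((m + (6 * N + 2) : ℕ) : ℝ))
      Filter.atTop (nhds 0) := fun a =>
    (tendsto_const_div_atTop_nhds_zero_nat a).comp (Filter.tendsto_add_atTop_nat _)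
  refine exists_flat_of_tendsto μ hμ S S γ hγ hbox ?_ ?_
  · intro k f L hf
    rw [tendsto_iff_dist_tendsto_zero]
    refine squeeze_zero (fun _ => dist_nonneg) (fun m => ?_) (hlim (L * S))
    rw [dist_comm, Real.dist_eq, mul_div_assoc]
    exact hmarg m k f L hf
  · have h1 := ((hlim S).const_mul (6 * N + 2 : ℝ)).add (hlim 1)
    simp only [mul_zero, add_zero] at h1
    exact squeeze_zero (fun m => integral_nonneg fun x => le_min (abs_nonneg _) zero_le_one) hsum h1

/-! ### Decreasing densities and supports -/

/-- The density cut off outside `[l, r]` is nonincreasing on `[l, ∞)`, so a shift to the right loses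
mass. Only this property of the density enters the construction. -/
theorem HasNonincreasingDensityOn.measure_Ico_add_le {μ : Measure ℝ} {l r : ℝ}
    (hμ : HasNonincreasingDensityOn μ l r) (hsupp : μ (Set.Icc l r)ᶜ = 0) {a b h : ℝ} (ha : l ≤ a)
    (hh : 0 ≤ h) : μ (Set.Ico (a + h) (b + h)) ≤ μ (Set.Ico a b) := by
  obtain ⟨ρ, hρm, hρ, hanti⟩ := hμ
  have hval : ∀ A, MeasurableSet A → μ A = ∫⁻ x in A, (Set.Icc l r).indicator ρ x := by
    intro A hA
    have h1 : μ A = μ (A ∩ Set.Icc l r) := by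
      refine le_antisymm ?_ (measure_mono Set.inter_subset_left)
      calc μ A ≤ μ (A ∩ Set.Icc l r ∪ (Set.Icc l r)ᶜ) := measure_mono fun x hx => by
            by_cases h : x ∈ Set.Icc l r
            · exact Or.inl ⟨hx, h⟩
            · exact Or.inr h
        _ ≤ μ (A ∩ Set.Icc l r) + μ (Set.Icc l r)ᶜ := measure_union_le _ _
        _ = μ (A ∩ Set.Icc l r) := by rw [hsupp, add_zero]
    rw [h1, hρ, withDensity_apply _ (hA.inter measurableSet_Icc), lintegral_indicator measurableSet_Icc,
      Measure.restrict_restrict measurableSet_Icc, Set.inter_comm]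
  rw [hval _ measurableSet_Ico, hval _ measurableSet_Ico]
  have hpre : (fun x : ℝ => x + h) ⁻¹' Set.Ico (a + h) (b + h) = Set.Ico a b := by
    ext x; simp
  have hmp := (measurePreserving_add_right (volume : Measure ℝ) h).setLIntegral_comp_preimage
    (measurableSet_Ico (a := a + h) (b := b + h)) (hρm.indicator (measurableSet_Icc (a := l) (b := r)))
  rw [← hmp, hpre]
  refine setLIntegral_mono (hρm.indicator measurableSet_Icc) fun x hx => ?_
  by_cases hxr : x + h ∈ Set.Icc l r
  · have hx' : x ∈ Set.Icc l r := ⟨ha.trans hx.1, by linarith [hxr.2]⟩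
    rw [Set.indicator_of_mem hxr, Set.indicator_of_mem hx']
    exact hanti hx' hxr (by linarith)
  · rw [Set.indicator_of_notMem hxr]
    exact zero_le

theorem lt_of_support_eq_Icc {μ : Measure ℝ} [IsProbabilityMeasure μ] (hac : μ ≪ volume) {l r : ℝ}
    (hsupp : μ.support = Set.Icc l r) : l < r := by
  by_contra hcon
  have h0 : μ (Set.Icc l r) = 0 := hac (by
    rw [Real.volume_Icc, ENNReal.ofReal_eq_zero]
    linarith)
  have h1 : μ (Set.Icc l r)ᶜ = 0 := hsupp ▸ Measure.measure_compl_support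
  have h2 := measure_union_null h0 h1
  rw [Set.union_compl_self, measure_univ] at h2
  exact one_ne_zero h2

/-! ### Necessity of the length condition, and optimality for the cost -/

section Plan

variable {N : ℕ} {μ : Fin N → Measure ℝ} {l r : Fin N → ℝ} {γ : Measure (Fin N → ℝ)}

theorem IsTransportPlan.ae_mem_box (hsupp : ∀ k, μ k (Set.Icc (l k) (r k))ᶜ = 0)
    (hγ : IsTransportPlan μ γ) : ∀ᵐ x ∂γ, x ∈ Set.Icc l r := by
  have h : ∀ k, ∀ᵐ x ∂γ, x k ∈ Set.Icc (l k) (r k) := by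
    intro k
    have h1 : ∀ᵐ x ∂μ k, x ∈ Set.Icc (l k) (r k) := hsupp k
    rw [← hγ.map_eval k] at h1
    exact ae_of_ae_map (measurable_pi_apply k).aemeasurable h1
  filter_upwards [ae_all_iff.2 h] with x hx
  exact ⟨fun k => (hx k).1, fun k => (hx k).2⟩

theorem IsTransportPlan.integrable_of_continuous (hsupp : ∀ k, μ k (Set.Icc (l k) (r k))ᶜ = 0)
    (hγ : IsTransportPlan μ γ) {F : (Fin N → ℝ) → ℝ} (hF : Continuous F) : Integrable F γ := by
  have := hγ.isProbabilityMeasure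
  have h : IntegrableOn F (Set.Icc l r) γ := hF.continuousOn.integrableOn_compact isCompact_Icc
  rwa [IntegrableOn, Measure.restrict_eq_self_of_ae_mem (hγ.ae_mem_box hsupp)] at h

theorem IsTransportPlan.integral_sum (hsupp : ∀ k, μ k (Set.Icc (l k) (r k))ᶜ = 0)
    (hγ : IsTransportPlan μ γ) {f : ℝ → ℝ} (hf : Continuous f) :
    ∫ x, ∑ i, f (x i) ∂γ = ∑ i, ∫ x, f x ∂μ i := by
  have hint : ∀ i, Integrable (fun x : Fin N → ℝ => f (x i)) γ := fun i =>
    hγ.integrable_of_continuous hsupp (hf.comp (continuous_apply i))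
  rw [integral_finsetSum _ fun i _ => hint i]
  refine Finset.sum_congr rfl fun i _ => ?_
  rw [← hγ.map_eval i, integral_map (measurable_pi_apply i).aemeasurable
    hf.aestronglyMeasurable]

theorem IsTransportPlan.eq_sum_means (hsupp : ∀ k, μ k (Set.Icc (l k) (r k))ᶜ = 0)
    (hγ : IsTransportPlan μ γ) {C : ℝ} (hC : ConcentratedOnHyperplane γ C) :
    C = ∑ i, ∫ x, x ∂μ i := by
  have := hγ.isProbabilityMeasure
  rw [← hγ.integral_sum hsupp (f := fun x => x) continuous_id, integral_congr_ae hC]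
  simp

/-- In a flat tuple no support is longer than the available room. -/
theorem IsTransportPlan.sub_le_of_concentrated (hsupp : ∀ k, (μ k).support = Set.Icc (l k) (r k))
    (hlr : ∀ k, l k ≤ r k) (hγ : IsTransportPlan μ γ) {C : ℝ} (hC : ConcentratedOnHyperplane γ C)
    (k : Fin N) : r k - l k ≤ C - ∑ i, l i := by
  have hnull : ∀ k, μ k (Set.Icc (l k) (r k))ᶜ = 0 := fun k =>
    hsupp k ▸ Measure.measure_compl_support
  have h1 : ∀ᵐ x ∂γ, x k ∈ Set.Iic (C - ∑ i, l i + l k) := by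
    filter_upwards [hγ.ae_mem_box hnull, hC] with x hx hxC
    have h2 : ∑ i ∈ Finset.univ.erase k, l i ≤ ∑ i ∈ Finset.univ.erase k, x i :=
      Finset.sum_le_sum fun i _ => hx.1 i
    rw [← Finset.add_sum_erase _ _ (Finset.mem_univ k)] at hxC
    rw [← Finset.add_sum_erase _ _ (Finset.mem_univ k), Set.mem_Iic]
    linarith
  have h2 : ∀ᵐ x ∂μ k, x ∈ Set.Iic (C - ∑ i, l i + l k) := by
    rw [← hγ.map_eval k]
    exact (ae_map_iff (f := fun x : Fin N → ℝ => x k)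
      (p := fun x : ℝ => x ∈ Set.Iic (C - ∑ i, l i + l k))
      (measurable_pi_apply k).aemeasurable measurableSet_Iic).2 h1
  -- Closedness of the half-line turns the almost sure bound into one at the support point `r k`.
  have h3 := Measure.support_subset_of_isClosed isClosed_Iic h2
  have h4 : r k ∈ (μ k).support := by rw [hsupp]; exact ⟨hlr k, le_rfl⟩
  have := h3 h4
  rw [Set.mem_Iic] at this
  linarith

/-- Expanding around `C` isolates the only non-separable term as a nonnegative square. -/
theorem repulsiveHarmonicCost_eq (x : Fin N → ℝ) (C : ℝ) :
    repulsiveHarmonicCost x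
      = ∑ i, (4 * C * x i - 2 * N * x i ^ 2) - 2 * C ^ 2 + 2 * (∑ i, x i - C) ^ 2 := by
  have h : ∑ i, ∑ j, (x i - x j) ^ 2 = 2 * N * ∑ i, x i ^ 2 - 2 * (∑ i, x i) ^ 2 := by
    have e : ∀ i j, (x i - x j) ^ 2 = x i ^ 2 + x j ^ 2 - 2 * (x i * x j) := fun i j => by ring
    simp only [e, Finset.sum_sub_distrib, Finset.sum_add_distrib, ← Finset.mul_sum,
      Finset.sum_const, Finset.card_univ, Fintype.card_fin, nsmul_eq_mul, ← Finset.sum_mul]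
    ring
  rw [repulsiveHarmonicCost, h, Finset.sum_sub_distrib, ← Finset.mul_sum, ← Finset.mul_sum]
  ring

theorem continuous_repulsiveHarmonicCost :
    Continuous (repulsiveHarmonicCost : (Fin N → ℝ) → ℝ) := by
  unfold repulsiveHarmonicCost
  fun_prop

theorem IsTransportPlan.integral_cost_le (hsupp : ∀ k, μ k (Set.Icc (l k) (r k))ᶜ = 0)
    (hγ : IsTransportPlan μ γ) {C : ℝ} (hC : ConcentratedOnHyperplane γ C)
    {γ' : Measure (Fin N → ℝ)} (hγ' : IsTransportPlan μ γ') :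
    ∫ x, repulsiveHarmonicCost x ∂γ ≤ ∫ x, repulsiveHarmonicCost x ∂γ' := by
  have := hγ.isProbabilityMeasure
  have := hγ'.isProbabilityMeasure
  have hsep : Continuous fun x : Fin N → ℝ => ∑ i, (4 * C * x i - 2 * N * x i ^ 2) := by fun_prop
  have hf : Continuous fun t : ℝ => 4 * C * t - 2 * N * t ^ 2 := by fun_prop
  calc ∫ x, repulsiveHarmonicCost x ∂γ
      = ∫ x, (∑ i, (4 * C * x i - 2 * N * x i ^ 2) - 2 * C ^ 2) ∂γ := by
        refine integral_congr_ae ?_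
        filter_upwards [hC] with x hx
        rw [repulsiveHarmonicCost_eq x C, hx]
        ring
    _ = ∫ x, (∑ i, (4 * C * x i - 2 * N * x i ^ 2) - 2 * C ^ 2) ∂γ' := by
        rw [integral_sub (hγ.integrable_of_continuous hsupp hsep) (integrable_const _),
          integral_sub (hγ'.integrable_of_continuous hsupp hsep) (integrable_const _),
          hγ.integral_sum hsupp hf, hγ'.integral_sum hsupp hf]
        simp
    _ ≤ ∫ x, repulsiveHarmonicCost x ∂γ' := by
        refine integral_mono (hγ'.integrable_of_continuous hsupp (by fun_prop))
          (hγ'.integrable_of_continuous hsupp continuous_repulsiveHarmonicCost) fun x => ?_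
        rw [repulsiveHarmonicCost_eq x C]
        have := sq_nonneg (∑ i, x i - C)
        simp only
        linarith

end Plan

/-! ### Translation to the origin and conclusion -/

/-- The mean condition suffices for flatness. -/
theorem isFlatTuple_of_length_le {N : ℕ} {μ : Fin N → Measure ℝ} {l r : Fin N → ℝ}
    (hprob : ∀ k, IsProbabilityMeasure (μ k)) (hac : ∀ k, μ k ≪ volume)
    (hnull : ∀ k, μ k (Set.Icc (l k) (r k))ᶜ = 0) (hlr : ∀ k, l k < r k)
    (hdens : ∀ k, HasNonincreasingDensityOn (μ k) (l k) (r k))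
    (hle : ∀ k, r k - l k ≤ (∑ i, ∫ x, x ∂μ i) - ∑ i, l i) : IsFlatTuple μ := by
  rcases Nat.eq_zero_or_pos N with rfl | hN
  · exact ⟨0, _, isTransportPlan_pi μ hprob, Filter.Eventually.of_forall fun x => by simp⟩
  obtain ⟨S, hS⟩ : ∃ S, S = (∑ i, ∫ x, x ∂μ i) - ∑ i, l i := ⟨_, rfl⟩
  rw [← hS] at hle
  have hSpos : 0 < S := (sub_pos.2 (hlr ⟨0, hN⟩)).trans_le (hle _)
  have hsub : ∀ k, Measurable fun x : ℝ => x - l k := fun k => by fun_prop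
  obtain ⟨ν, hν⟩ : ∃ ν : Fin N → Measure ℝ, ∀ k, ν k = (μ k).map fun x => x - l k :=
    ⟨_, fun _ => rfl⟩
  have hpre : ∀ k a b, (fun x : ℝ => x - l k) ⁻¹' Set.Ico a b = Set.Ico (l k + a) (l k + b) := by
    intro k a b
    ext x
    simp only [Set.mem_preimage, Set.mem_Ico]
    constructor <;> rintro ⟨h1, h2⟩ <;> constructor <;> linarith
  obtain ⟨γ, hγ, hγS⟩ := exists_flat_of_decreasing ν
    (fun k => by rw [hν]; exact Measure.isProbabilityMeasure_map (hsub k).aemeasurable) hSpos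
    (fun k => by
      rw [hν, Measure.map_apply (hsub k) measurableSet_Ico.compl, Set.preimage_compl, hpre]
      -- The cells are half-open, so when `r k - l k = S` the right end must be discarded; absolute
      -- continuity makes it null.
      have hr : μ k {r k} = 0 := hac k (by simp)
      refine measure_mono_null (t := (Set.Icc (l k) (r k))ᶜ ∪ {r k}) (fun x hx => ?_)
        (measure_union_null (hnull k) hr)
      by_contra hcon
      rw [Set.mem_union, not_or, Set.notMem_compl_iff, Set.mem_singleton_iff] at hcon
      have := lt_of_le_of_ne hcon.1.2 hcon.2
      exact hx ⟨by linarith [hcon.1.1], by linarith [hle k]⟩)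
    (fun k h hh j => by
      have hj : (0 : ℝ) ≤ j * h := by positivity
      rw [hν, Measure.map_apply (hsub k) measurableSet_Ico,
        Measure.map_apply (hsub k) measurableSet_Ico, hpre, hpre]
      have := (hdens k).measure_Ico_add_le (hnull k) (a := l k + j * h) (b := l k + (j + 1) * h)
        (h := h) (by linarith) hh.le
      convert this using 3 <;> push_cast <;> ring)
    (by
      rw [hS, ← Finset.sum_sub_distrib]
      refine Finset.sum_congr rfl fun k _ => ?_
      have hint : Integrable (fun x : ℝ => x) (μ k) := by
        have h : IntegrableOn (fun x : ℝ => x) (Set.Icc (l k) (r k)) (μ k) :=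
          continuous_id.continuousOn.integrableOn_Icc
        have hae : ∀ᵐ x ∂μ k, x ∈ Set.Icc (l k) (r k) := hnull k
        rwa [IntegrableOn, Measure.restrict_eq_self_of_ae_mem hae] at h
      rw [hν, integral_map (hsub k).aemeasurable (by fun_prop),
        integral_sub hint (integrable_const _)]
      simp)
  have hm : Measurable fun (x : Fin N → ℝ) k => x k + l k :=
    measurable_pi_lambda _ fun k => by fun_prop
  have := hγ.isProbabilityMeasure
  refine ⟨S + ∑ i, l i, γ.map fun x k => x k + l k,
    ⟨Measure.isProbabilityMeasure_map hm.aemeasurable, fun k => ?_⟩, ?_⟩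
  · rw [Measure.map_map (measurable_pi_apply k) hm]
    have e : ((fun x : Fin N → ℝ => x k) ∘ fun (x : Fin N → ℝ) k => x k + l k)
        = (fun t => t + l k) ∘ fun x => x k := rfl
    rw [e, ← Measure.map_map (g := fun t : ℝ => t + l k) (f := fun x : Fin N → ℝ => x k)
      (by fun_prop) (by fun_prop), hγ.map_eval, hν, Measure.map_map (by fun_prop) (hsub k)]
    have e' : ((fun t : ℝ => t + l k) ∘ fun x => x - l k) = id := by funext x; simp
    rw [e', Measure.map_id]
  · unfold ConcentratedOnHyperplane
    rw [ae_map_iff hm.aemeasurable (measurableSet_eq_fun (by fun_prop) (by fun_prop))]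
    filter_upwards [hγS] with x hx
    rw [Finset.sum_add_distrib, hx]

theorem theorem1 (N : ℕ) (μ : Fin N → Measure ℝ) (l r : Fin N → ℝ)
    (hprob : ∀ k, IsProbabilityMeasure (μ k))
    (hac : ∀ k, μ k ≪ volume)
    (hsupp : ∀ k, (μ k).support = Set.Icc (l k) (r k))
    (hdens : ∀ k, HasNonincreasingDensityOn (μ k) (l k) (r k)) :
    (IsFlatTuple μ ↔ ∀ k, r k - l k ≤ (∑ i, (∫ x, x ∂(μ i))) - (∑ i, l i)) ∧
    (∀ γ : Measure (Fin N → ℝ), IsTransportPlan μ γ → Integrable repulsiveHarmonicCost γ) ∧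
    (∀ (C : ℝ) (γ : Measure (Fin N → ℝ)),
      IsTransportPlan μ γ → ConcentratedOnHyperplane γ C →
      ∀ γ' : Measure (Fin N → ℝ), IsTransportPlan μ γ' →
        ∫ x, repulsiveHarmonicCost x ∂γ ≤ ∫ x, repulsiveHarmonicCost x ∂γ') := by
  have hnull : ∀ k, μ k (Set.Icc (l k) (r k))ᶜ = 0 := fun k =>
    hsupp k ▸ Measure.measure_compl_support
  have hlr : ∀ k, l k < r k := fun k => lt_of_support_eq_Icc (hac k) (hsupp k)
  refine ⟨⟨?_, isFlatTuple_of_length_le hprob hac hnull hlr hdens⟩, ?_, ?_⟩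
  · rintro ⟨C, γ, hγ, hC⟩ k
    rw [← hγ.eq_sum_means hnull hC]
    exact hγ.sub_le_of_concentrated hsupp (fun k => (hlr k).le) hC k
  · exact fun γ hγ => hγ.integrable_of_continuous hnull continuous_repulsiveHarmonicCost
  · exact fun C γ hγ hC γ' hγ' => hγ.integral_cost_le hnull hC hγ'
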